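/- Let $\lambda:\mathbb{Z}_+=\{0,1,2,\dots\}\to(0,\infty)$ satisfy $0<\inf_x\lambda(x)\le\sup_x\lambda(x)<\infty$. Write $[\nabla^+f](x)=f(x+1)-f(x)$ and $[\nabla^-f](x)=f(x-1)-f(x)$, and let $\mathsf{L}=\lambda(x)\nabla^+_x$ be the generator of the pure-birth chain that jumps from $x$ to $x+1$ at rate $\lambda(x)$. Let $(e^{t\mathsf{L}})_{t\ge0}$ be its semigroup (the exponential of the bounded operator $t\mathsf{L}$ on bounded functions), $e^{t\mathsf{L}}(x,y)=[e^{t\mathsf{L}}\mathbf{1}_{\{y\}}](x)$ its transition density, and $\mathbf{1}_{[\![0,y]\!]}$ the indicator function of $\{0,\dots,y\}$ (zero if $y=-1$). For $N\ge 0$ let $$\mathbb{W}^{N,N+1}=\{(y,x)\in\mathbb{Z}_+^{N}\times\mathbb{Z}_+^{N+1}: x_1\le y_1<x_2\le\cdots\le y_N<x_{N+1}\},$$ and for $t\ge0$, $(y,x),(y',x')\in\mathbb{W}^{N,N+1}$ put $$\mathsf{U}_t[(y,x),(y',x')]=\det\begin{pmatrix}\mathsf{A}_t&\mathsf{B}_t\\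 \mathsf{C}_t&\mathsf{D}_t\end{pmatrix},$$ the determinant of size $2N+1$ with blocks $$(\mathsf{A}_t)_{ij}=e^{t\mathsf{L}}(x_i,x'_j),\qquad (\mathsf{B}_t)_{ij}=\lambda(y'_j)^{-1}\bigl([e^{t\mathsf{L}}\mathbf{1}_{[\![0,y'_j]\!]}](x_i)-\mathbf{1}(j\ge i)\bigr),$$ $$(\mathsf{C}_t)_{ij}=\lambda(y_i)\nabla^+_{y_i}\nabla^-_{x'_j}[e^{t\mathsf{L}}\mathbf{1}_{[\![0,x'_j]\!]}](y_i),\qquad (\mathsf{D}_t)_{ij}=e^{t\mathsf{L}}(y_i,y'_j),$$ of sizes $(N+1)\times(N+1)$, $(N+1)\times N$, $N\times(N+1)$ and $N\times N$. The two-level push-block dynamics is the following continuous-time Markov chain on $\mathbb{W}^{N,N+1}$ with a cemetery. In state $(y,x)$ each of the $2N+1$ particles carries an independent exponential clock whose rate is $\lambda$ at its position, and the particle whose clock rings first attempts to jump to the right by one; after each ring the clocks are renewed. If $X$-particle $i$ rings, it moves to $x_i+1$ unless this breaks the interlacing, in which case the jump is blocked and nothing changes. If $Y$-particle $i$ rings,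 it moves to $y_i+1$; if this is the position of another $Y$-particle, the process is killed, and otherwise, if the interlacing with $x_{i+1}$ is broken, $x_{i+1}$ is pushed to $x_{i+1}+1$ at the same time. Then $\mathsf{U}_t$ is the transition density of this dynamics. Precisely: 1. $\mathsf{U}_t\ge0$ and $\sum_{z'}\mathsf{U}_t[z,z']\le1$ for all $t\ge0$ and $z\in\mathbb{W}^{N,N+1}$. 2. $\mathsf{U}_0[z,z']=\mathbf{1}(z=z')$, and $\mathsf{U}_t$ solves the Kolmogorov backward equation: for all $t\ge0$ (one-sided derivative at $t=0$) and $z,z'\in\mathbb{W}^{N,N+1}$, $\frac{d}{dt}\mathsf{U}_t[z,z']=\sum_{a}\lambda(z_a)\bigl(\mathsf{U}_t[z^{a},z']-\mathsf{U}_t[z,z']\bigr)$, where the sum is over the $2N+1$ particles, $z_a$ is the position of particle $a$, $z^{a}$ is the state after its clock rings, and $\mathsf{U}_t[z^a,z']=0$ if the process is then killed. 3. If $(Z(t))_{t\ge0}$ is the dynamics started from $z_0\in\mathbb{W}^{N,N+1}$, then for all $n\ge0$, $0=t_0\le t_1\le\dots\le t_n$ and $z_1,\dots,z_n\in\mathbb{W}^{N,N+1}$,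 $$\mathbb{P}\bigl(Z(t_k)=z_k,\ 0\le k\le n\bigr)=\prod_{k=0}^{n-1}\mathsf{U}_{t_{k+1}-t_k}[z_k,z_{k+1}].$$ In particular $\mathbb{P}(Z(t)=z')=\mathsf{U}_t[z_0,z']$ for all $t\ge 0$ and $z'\in\mathbb{W}^{N,N+1}$. -/

import Mathlib

namespace TwoLevel

noncomputable section

/-! ### The pure-birth chain -/

/-- The standing assumption on the rates: they are uniformly bounded away from `0` and `∞`. -/
def UniformlyBounded (lam : ℕ → ℝ) : Prop :=
  ∃ s M : ℝ, 0 < s ∧ ∀ x, s ≤ lam x ∧ lam x ≤ M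

/-- The forward discrete derivative `(∇⁺ f)(x) = f (x + 1) - f x`. -/
def nablaPlus (f : ℕ → ℝ) (x : ℕ) : ℝ := f (x + 1) - f x

/-- The backward discrete derivative `(∇⁻ f)(x) = f (x - 1) - f x`, on the integers. -/
def nablaMinus (f : ℤ → ℝ) (x : ℤ) : ℝ := f (x - 1) - f x

/-- The generator `L = lam ∇⁺` of the pure-birth chain. -/
def birthGenerator (lam : ℕ → ℝ) (f : ℕ → ℝ) (x : ℕ) : ℝ := lam x * nablaPlus f x

/-- The semigroup `e^{tL} f = ∑ₙ tⁿ/n! Lⁿ f` of the pure-birth chain. For bounded rates `L` is a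
bounded operator on the bounded functions on `ℕ`, and this is its exponential; the convergence of
the series is `summable_birthSemigroup` below. -/
def birthSemigroup (lam : ℕ → ℝ) (t : ℝ) (f : ℕ → ℝ) (x : ℕ) : ℝ :=
  ∑' n : ℕ, t ^ n / (n.factorial : ℝ) * (birthGenerator lam)^[n] f x

theorem summable_birthSemigroup {lam : ℕ → ℝ} (hlam : UniformlyBounded lam) (t : ℝ)
    {f : ℕ → ℝ} {K : ℝ} (hf : ∀ x, |f x| ≤ K) (x : ℕ) :
    Summable fun n : ℕ => t ^ n / (n.factorial : ℝ) * (birthGenerator lam)^[n] f x := by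
  obtain ⟨s, M, hs, h⟩ := hlam
  have hM : 0 ≤ M := by linarith [(h 0).1, (h 0).2]
  have key : ∀ n x, |(birthGenerator lam)^[n] f x| ≤ (2 * M) ^ n * K := by
    intro n
    induction n with
    | zero => intro x; simpa using hf x
    | succ n ih =>
      intro x
      rw [Function.iterate_succ_apply', birthGenerator, nablaPlus, abs_mul,
        abs_of_pos (lt_of_lt_of_le hs (h x).1)]
      have h1 := ih x
      have h2 := ih (x + 1)
      have h3 := abs_sub ((birthGenerator lam)^[n] f (x + 1)) ((birthGenerator lam)^[n] f x)
      calc _ ≤ M * ((2 * M) ^ n * K + (2 * M) ^ n * K) :=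
            mul_le_mul (h x).2 (by linarith) (abs_nonneg _) hM
        _ = _ := by ring
  refine Summable.of_norm_bounded (g := fun n : ℕ => (|t| * (2 * M)) ^ n / (n.factorial : ℝ) * K)
    ((Real.summable_pow_div_factorial _).mul_right K) fun n => ?_
  rw [Real.norm_eq_abs, abs_mul, abs_div, abs_pow, Nat.abs_cast]
  calc _ ≤ |t| ^ n / (n.factorial : ℝ) * ((2 * M) ^ n * K) := by
        gcongr
        exact key n x
    _ = _ := by rw [mul_pow]; ring

/-- The transition density `e^{tL}(x, y)` of the pure-birth chain. -/
def birthDensity (lam : ℕ → ℝ) (t : ℝ) (x y : ℕ) : ℝ :=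
  birthSemigroup lam t (Set.indicator {y} 1) x

/-- `(e^{tL} 1_{⟦0, y⟧})(x)`, where `⟦0, y⟧ = {0, 1, …, y}`, which is empty for `y = -1`. -/
def birthCumul (lam : ℕ → ℝ) (t : ℝ) (x : ℕ) (y : ℤ) : ℝ :=
  birthSemigroup lam t (Set.indicator {k : ℕ | (k : ℤ) ≤ y} 1) x

/-! ### Interlacing pairs -/

/-- The interlacing condition `x₁ ≤ y₁ < x₂ ≤ ⋯ ≤ y_N < x_{N+1}`. -/
def Interlaces {N : ℕ} (y : Fin N → ℕ) (x : Fin (N + 1) → ℕ) : Prop :=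
  ∀ i : Fin N, x i.castSucc ≤ y i ∧ y i < x i.succ

/-- The space `𝕎^{N,N+1}` of interlacing pairs `(y, x)`. -/
@[ext]
structure State (N : ℕ) where
  y : Fin N → ℕ
  x : Fin (N + 1) → ℕ
  interlaces : Interlaces y x

/-! ### The block determinant kernel -/

/-- The block `A_t`. -/
def blockA (lam : ℕ → ℝ) (t : ℝ) {N : ℕ} (z z' : State N) :
    Matrix (Fin (N + 1)) (Fin (N + 1)) ℝ :=
  Matrix.of fun i j => birthDensity lam t (z.x i) (z'.x j)

/-- The block `B_t`. -/
def blockB (lam : ℕ → ℝ) (t : ℝ) {N : ℕ} (z z' : State N) :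
    Matrix (Fin (N + 1)) (Fin N) ℝ :=
  Matrix.of fun i j =>
    (lam (z'.y j))⁻¹ *
      (birthCumul lam t (z.x i) (z'.y j) - if (i : ℕ) ≤ (j : ℕ) then 1 else 0)

/-- The block `C_t`. -/
def blockC (lam : ℕ → ℝ) (t : ℝ) {N : ℕ} (z z' : State N) :
    Matrix (Fin N) (Fin (N + 1)) ℝ :=
  Matrix.of fun i j =>
    lam (z.y i) *
      nablaPlus (fun u => nablaMinus (fun v => birthCumul lam t u v) (z'.x j)) (z.y i)

/-- The block `D_t`. -/
def blockD (lam : ℕ → ℝ) (t : ℝ) {N : ℕ} (z z' : State N) :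
    Matrix (Fin N) (Fin N) ℝ :=
  Matrix.of fun i j => birthDensity lam t (z.y i) (z'.y j)

/-- The two-level Karlin–McGregor kernel `U_t^{N,N+1}[(y, x), (y', x')]`. -/
def kernelU (lam : ℕ → ℝ) (t : ℝ) {N : ℕ} (z z' : State N) : ℝ :=
  (Matrix.fromBlocks (blockA lam t z z') (blockB lam t z z')
    (blockC lam t z z') (blockD lam t z z')).det

/-! ### The two-level push-block dynamics -/

/-- The `2N+1` particles: `inl i` is the `i`-th `Y`-particle, `inr i` the `i`-th `X`-particle. -/
abbrev Particle (N : ℕ) : Type := Fin N ⊕ Fin (N + 1)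

/-- The position of a particle. -/
def State.pos {N : ℕ} (z : State N) : Particle N → ℕ
  | Sum.inl i => z.y i
  | Sum.inr i => z.x i

/-- The `X`-configuration after the `i`-th `Y`-particle has moved one step to the right: if the
move breaks the interlacing with `x_{i+1}`, then `x_{i+1}` is pushed to the right by one. -/
def State.pushedX {N : ℕ} (z : State N) (i : Fin N) : Fin (N + 1) → ℕ :=
  if z.y i + 1 < z.x i.succ then z.x
  else Function.update z.x i.succ (z.x i.succ + 1)

/-- A move of a `Y`-particle that does not collide with another `Y`-particle, together with the
push it may trigger, preserves the interlacing. -/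
theorem State.interlaces_pushedX {N : ℕ} (z : State N) (i : Fin N)
    (h : ¬ ∃ j, z.y j = z.y i + 1) :
    Interlaces (Function.update z.y i (z.y i + 1)) (z.pushedX i) := by
  intro k
  have hk := z.interlaces k
  have hi := z.interlaces i
  have hne : z.y k ≠ z.y i + 1 := fun e => h ⟨k, e⟩
  unfold State.pushedX
  by_cases hki : k = i
  · subst hki
    have h1 : k.castSucc ≠ k.succ := (Fin.castSucc_lt_succ (i := k)).ne
    split_ifs with hp
    · simp only [Function.update_self]; omega
    · simp only [Function.update_self, Function.update_of_ne h1]; omega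
  · have h1 : k.succ ≠ i.succ := fun e => hki (Fin.succ_injective _ e)
    split_ifs with hp
    · simp only [Function.update_of_ne hki]; omega
    · simp only [Function.update_of_ne hki, Function.update_of_ne h1]
      by_cases hc : k.castSucc = i.succ
      · rw [hc] at hk
        rw [hc, Function.update_self]
        omega
      · rw [Function.update_of_ne hc]
        omega

open Classical in
/-- The `i`-th `Y`-particle jumps to the right by one, pushing `x_{i+1}` if necessary; the
process is killed (`none`) if this makes two `Y`-particles collide. -/
def State.ringY {N : ℕ} (z : State N) (i : Fin N) : Option (State N) :=
  if h : ∃ j, z.y j = z.y i + 1 then none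
  else some ⟨Function.update z.y i (z.y i + 1), z.pushedX i, z.interlaces_pushedX i h⟩

open Classical in
/-- The `i`-th `X`-particle jumps to the right by one, unless this breaks the interlacing, in
which case the jump is blocked. -/
def State.ringX {N : ℕ} (z : State N) (i : Fin (N + 1)) : State N :=
  if h : Interlaces z.y (Function.update z.x i (z.x i + 1)) then
    ⟨z.y, Function.update z.x i (z.x i + 1), h⟩
  else z

/-- The state after the clock of particle `a` has rung (`none` if the process is killed). -/
def State.ring {N : ℕ} (z : State N) : Particle N → Option (State N)
  | Sum.inl i => z.ringY i
  | Sum.inr i => some (z.ringX i)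

/-- The generator of the dynamics:
`(G f)(z) = ∑ₐ lam (position of a) * (f (state after a rings) - f z)`, where `f` is `0` at the
cemetery. -/
def generator (lam : ℕ → ℝ) {N : ℕ} (f : State N → ℝ) (z : State N) : ℝ :=
  ∑ a : Particle N, lam (z.pos a) * ((z.ring a).elim 0 f - f z)

/-- The time until the clock of particle `a` rings in state `z`, when `e a` are standard
exponential variables: an exponential variable of rate `lam (z.pos a)`. -/
def clockTime (lam : ℕ → ℝ) {N : ℕ} (z : State N) (e : Particle N → ℝ) (a : Particle N) : ℝ :=
  e a / lam (z.pos a)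

/-- The particle whose clock rings first in state `z`. -/
def firstRing (lam : ℕ → ℝ) {N : ℕ} (z : State N) (e : Particle N → ℝ) : Particle N :=
  (Finite.exists_min (clockTime lam z e)).choose

/-- The time and the state (`none` once killed) right after the `n`-th ring, for the process
started from `z`, where `e (n, a)` is the standard exponential variable that drives the clock of
particle `a` between the `n`-th and the `(n+1)`-st ring. -/
def ringChain (lam : ℕ → ℝ) {N : ℕ} (z : State N) (e : ℕ × Particle N → ℝ) :
    ℕ → ℝ × Option (State N)
  | 0 => (0, some z)
  | n + 1 =>
    match ringChain lam z e n with
    | (s, none) => (s, none)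
    | (s, some w) =>
      let b := firstRing lam w (fun a => e (n, a))
      (s + clockTime lam w (fun a => e (n, a)) b, w.ring b)

open Classical in
/-- The state at time `t` of the two-level push-block dynamics started from `z` (`none` once
killed): the state after the last ring up to time `t`. -/
def process (lam : ℕ → ℝ) {N : ℕ} (z : State N) (e : ℕ × Particle N → ℝ) (t : ℝ) :
    Option (State N) :=
  if h : ∃ n, (ringChain lam z e n).1 ≤ t ∧ t < (ringChain lam z e (n + 1)).1 then
    (ringChain lam z e (Nat.find h)).2
  else none

end

end TwoLevel

namespace TwoLevel

/-! ### The semigroup of the pure-birth chain -/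

/-! The kernel is extended to arbitrary positions of the particles: `posMatrix` has one row per
particle, and each row depends only on the position (and index) of its own particle. Each row solves
the one-particle backward equation, so by multilinearity the determinant solves the backward
equation of free, non-interacting particles (`hasDerivAt_det_posMatrix`).

The interaction is encoded in linear relations between rows. From `L e^{tL} 1_{⟦0,y⟧} = -λ(y) e^{tL}
1_{y}`, moving an `X`-particle from `u` to `u + 1` changes its row by a multiple of the row of a
`Y`-particle at `u` (`rowX_succ`). Hence if `x_i = y_k`, replacing `x_i` by `x_i + 1` leaves the
determinant unchanged. This one boundary condition gives both blocking and pushing; killing is the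
vanishing of a determinant with two equal `Y`-rows. The free equation therefore restricts to the
generator of the dynamics on interlacing states. At time `0` the matrix is block triangular with
identity blocks if `z = z'`; otherwise the first disagreement in the order `x_1, y_1, x_2, …` makes
it singular.

To identify the kernel with the law of the process, both are shown to solve the renewal equation at
the first ring. Bounded solutions with given initial values are unique because the rates are
bounded: the equation is a contraction on each finite time interval (`IsRenewal.unique`). On the
probabilistic side the equation is solved by the probability of being at `w_k` at time `s + d_k` for
all `k ≤ n`, as a function of the starting state and of `s`. With `d_0 = 0` its value at `s = 0`
vanishes unless the start is `w_0`, so uniqueness yields `U_s[z, w_0]` times that value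
(`pathProb_eq_kernelU_mul`). This contains the Markov property, and induction on `n` gives all
finite-dimensional distributions. Positivity and substochasticity follow since the kernel consists
of probabilities of disjoint events. -/

theorem summable_pow_div_factorial_mul {a : ℕ → ℝ} {C K : ℝ} (ha : ∀ n, |a n| ≤ C ^ n * K)
    (t : ℝ) : Summable fun n : ℕ => t ^ n / (n.factorial : ℝ) * a n := by
  refine Summable.of_norm_bounded (g := fun n : ℕ => (|t| * C) ^ n / (n.factorial : ℝ) * K)
    ((Real.summable_pow_div_factorial _).mul_right K) fun n => ?_
  rw [Real.norm_eq_abs, abs_mul, abs_div, abs_pow, Nat.abs_cast]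
  calc _ ≤ |t| ^ n / (n.factorial : ℝ) * (C ^ n * K) := by
        gcongr
        exact ha n
    _ = _ := by rw [mul_pow]; ring

theorem abs_tsum_pow_div_factorial_le {a : ℕ → ℝ} {C K : ℝ} (ha : ∀ n, |a n| ≤ C ^ n * K)
    (t : ℝ) : |∑' n : ℕ, t ^ n / (n.factorial : ℝ) * a n| ≤ Real.exp (|t| * C) * K := by
  have hexp : HasSum (fun n : ℕ => (|t| * C) ^ n / (n.factorial : ℝ)) (Real.exp (|t| * C)) := by
    rw [Real.exp_eq_exp_ℝ]
    exact NormedSpace.expSeries_div_hasSum_exp (|t| * C)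
  rw [← Real.norm_eq_abs]
  refine tsum_of_norm_bounded (hexp.mul_right K) fun n => ?_
  rw [Real.norm_eq_abs, abs_mul, abs_div, abs_pow, Nat.abs_cast]
  calc _ ≤ |t| ^ n / (n.factorial : ℝ) * (C ^ n * K) := by
        gcongr
        exact ha n
    _ = _ := by rw [mul_pow]; ring

theorem hasDerivAt_tsum_pow_div_factorial {a : ℕ → ℝ} {C K : ℝ}
    (ha : ∀ n, |a n| ≤ C ^ n * K) (t : ℝ) :
    HasDerivAt (fun r => ∑' n : ℕ, r ^ n / (n.factorial : ℝ) * a n)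
      (∑' n : ℕ, t ^ n / (n.factorial : ℝ) * a (n + 1)) t := by
  -- Any radius larger than `|t|` works: the derivatives of the terms are dominated uniformly on the
  -- ball of radius `R`.
  set R : ℝ := |t| + 1
  have ha' : ∀ n, |a (n + 1)| ≤ C ^ n * (C * K) := fun n => (ha (n + 1)).trans_eq (by ring)
  have hsum : Summable fun n : ℕ => R ^ (n - 1) * n / (n.factorial : ℝ) * (C ^ n * K) := by
    rw [← summable_nat_add_iff 1]
    refine ((Real.summable_pow_div_factorial (R * C)).mul_right (C * K)).congr fun n => ?_
    rw [Nat.add_sub_cancel, Nat.factorial_succ]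
    push_cast
    rw [mul_pow]
    field_simp
    ring
  have key := hasDerivAt_tsum_of_isPreconnected (𝕜 := ℝ) (t := Metric.ball (0 : ℝ) R)
    (g := fun n r => r ^ n / (n.factorial : ℝ) * a n)
    (g' := fun n r => (n * r ^ (n - 1)) / (n.factorial : ℝ) * a n)
    (y₀ := 0) (y := t) hsum Metric.isOpen_ball (convex_ball _ _).isPreconnected
    (fun n y _ => ((hasDerivAt_pow n y).div_const _).mul_const _)
    (fun n y hy => by
      rw [mem_ball_zero_iff, Real.norm_eq_abs] at hy
      rw [Real.norm_eq_abs, abs_mul, abs_div, abs_mul, abs_pow, Nat.abs_cast, Nat.abs_cast,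
        mul_comm (n : ℝ)]
      gcongr
      exact ha n)
    (by simp; positivity) (summable_pow_div_factorial_mul ha 0) (by simp [R])
  refine key.congr_deriv ?_
  -- The truncated exponent `n - 1` is harmless at `n = 0`, where the factor `n` kills the term;
  -- dropping that term shifts the index.
  have hs : Summable fun n : ℕ => (n * t ^ (n - 1)) / (n.factorial : ℝ) * a n := by
    rw [← summable_nat_add_iff 1]
    refine (summable_pow_div_factorial_mul ha' t).congr fun n => ?_
    rw [Nat.add_sub_cancel, Nat.factorial_succ]
    push_cast
    field_simp
  rw [hs.tsum_eq_zero_add]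
  simp only [Nat.cast_zero, zero_mul, zero_div, zero_add]
  refine tsum_congr fun n => ?_
  rw [Nat.add_sub_cancel, Nat.factorial_succ]
  push_cast
  field_simp

variable {lam : ℕ → ℝ}

theorem UniformlyBounded.pos (hlam : UniformlyBounded lam) (x : ℕ) : 0 < lam x := by
  obtain ⟨s, M, hs, h⟩ := hlam
  exact hs.trans_le (h x).1

theorem UniformlyBounded.exists_le (hlam : UniformlyBounded lam) : ∃ M, 0 < M ∧ ∀ x, lam x ≤ M := by
  obtain ⟨s, M, hs, h⟩ := hlam
  exact ⟨M, hs.trans_le ((h 0).1.trans (h 0).2), fun x => (h x).2⟩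

theorem UniformlyBounded.exists_inv_le (hlam : UniformlyBounded lam) :
    ∃ K, 0 < K ∧ ∀ x, (lam x)⁻¹ ≤ K := by
  obtain ⟨s, M, hs, h⟩ := hlam
  exact ⟨s⁻¹, inv_pos.2 hs, fun x => inv_anti₀ hs (h x).1⟩

theorem abs_iterate_birthGenerator_le (hlam : UniformlyBounded lam) {M : ℝ} (hM : ∀ x, lam x ≤ M)
    {f : ℕ → ℝ} {K : ℝ} (hf : ∀ x, |f x| ≤ K) (n x : ℕ) :
    |(birthGenerator lam)^[n] f x| ≤ (2 * M) ^ n * K := by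
  induction n generalizing x with
  | zero => simpa using hf x
  | succ n ih =>
    rw [Function.iterate_succ_apply', birthGenerator, nablaPlus, abs_mul, abs_of_pos (hlam.pos x)]
    have h1 := ih x
    have h2 := ih (x + 1)
    have h3 := abs_sub ((birthGenerator lam)^[n] f (x + 1)) ((birthGenerator lam)^[n] f x)
    calc _ ≤ M * ((2 * M) ^ n * K + (2 * M) ^ n * K) :=
          mul_le_mul (hM x) (by linarith) (abs_nonneg _) ((hlam.pos 0).le.trans (hM 0))
      _ = _ := by ring

theorem hasDerivAt_birthSemigroup (hlam : UniformlyBounded lam) {f : ℕ → ℝ} {K : ℝ}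
    (hf : ∀ x, |f x| ≤ K) (t : ℝ) (x : ℕ) :
    HasDerivAt (fun r => birthSemigroup lam r f x)
      (birthSemigroup lam t (birthGenerator lam f) x) t := by
  obtain ⟨M, hM0, hM⟩ := hlam.exists_le
  exact hasDerivAt_tsum_pow_div_factorial
    (fun n => abs_iterate_birthGenerator_le hlam hM hf n x) t

theorem birthGenerator_birthSemigroup (hlam : UniformlyBounded lam) {f : ℕ → ℝ} {K : ℝ}
    (hf : ∀ x, |f x| ≤ K) (t : ℝ) (x : ℕ) :
    birthGenerator lam (birthSemigroup lam t f) x =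
      birthSemigroup lam t (birthGenerator lam f) x := by
  simp only [birthGenerator.eq_def lam (birthSemigroup lam t f), nablaPlus, birthSemigroup]
  rw [← (summable_birthSemigroup hlam t hf (x + 1)).tsum_sub (summable_birthSemigroup hlam t hf x),
    ← tsum_mul_left]
  refine tsum_congr fun n => ?_
  rw [← Function.iterate_succ_apply, Function.iterate_succ_apply', birthGenerator, nablaPlus]
  ring

theorem iterate_birthGenerator_add (n : ℕ) (f g : ℕ → ℝ) (x : ℕ) :
    (birthGenerator lam)^[n] (fun u => f u + g u) x =
      (birthGenerator lam)^[n] f x + (birthGenerator lam)^[n] g x := by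
  induction n generalizing x with
  | zero => rfl
  | succ n ih =>
    simp only [Function.iterate_succ_apply', birthGenerator, nablaPlus, ih]
    ring

theorem iterate_birthGenerator_const_mul (n : ℕ) (c : ℝ) (f : ℕ → ℝ) (x : ℕ) :
    (birthGenerator lam)^[n] (fun u => c * f u) x = c * (birthGenerator lam)^[n] f x := by
  induction n generalizing x with
  | zero => rfl
  | succ n ih =>
    simp only [Function.iterate_succ_apply', birthGenerator, nablaPlus, ih]
    ring

theorem birthSemigroup_add (hlam : UniformlyBounded lam) {f g : ℕ → ℝ} {K K' : ℝ}
    (hf : ∀ x, |f x| ≤ K) (hg : ∀ x, |g x| ≤ K') (t : ℝ) (x : ℕ) :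
    birthSemigroup lam t (fun u => f u + g u) x =
      birthSemigroup lam t f x + birthSemigroup lam t g x := by
  simp only [birthSemigroup]
  rw [← (summable_birthSemigroup hlam t hf x).tsum_add (summable_birthSemigroup hlam t hg x)]
  refine tsum_congr fun n => ?_
  rw [iterate_birthGenerator_add, mul_add]

theorem birthSemigroup_const_mul (c : ℝ) (f : ℕ → ℝ) (t : ℝ) (x : ℕ) :
    birthSemigroup lam t (fun u => c * f u) x = c * birthSemigroup lam t f x := by
  simp only [birthSemigroup]
  rw [← tsum_mul_left]
  refine tsum_congr fun n => ?_
  rw [iterate_birthGenerator_const_mul]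
  ring

theorem birthSemigroup_zero (f : ℕ → ℝ) (x : ℕ) : birthSemigroup lam 0 f x = f x := by
  rw [birthSemigroup, tsum_eq_single 0 fun n hn => by simp [hn]]
  simp

theorem abs_birthSemigroup_le (hlam : UniformlyBounded lam) {M : ℝ} (hM : ∀ x, lam x ≤ M)
    {f : ℕ → ℝ} {K : ℝ} (hf : ∀ x, |f x| ≤ K) (t : ℝ) (x : ℕ) :
    |birthSemigroup lam t f x| ≤ Real.exp (|t| * (2 * M)) * K :=
  abs_tsum_pow_div_factorial_le (fun n => abs_iterate_birthGenerator_le hlam hM hf n x) t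

theorem abs_indicator_one_le (s : Set ℕ) (x : ℕ) : |s.indicator (1 : ℕ → ℝ) x| ≤ 1 := by
  by_cases h : x ∈ s <;> simp [h]

theorem birthDensity_zero (x y : ℕ) : birthDensity lam 0 x y = if x = y then 1 else 0 := by
  rw [birthDensity, birthSemigroup_zero]
  by_cases h : x = y <;> simp [h]

theorem birthCumul_zero (x y : ℕ) : birthCumul lam 0 x y = if x ≤ y then 1 else 0 := by
  rw [birthCumul, birthSemigroup_zero]
  by_cases h : x ≤ y <;> simp [h]

theorem birthGenerator_indicator_Iic (y : ℕ) :
    birthGenerator lam ({k : ℕ | (k : ℤ) ≤ (y : ℤ)}.indicator 1) =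
      fun x => -lam y * Set.indicator {y} 1 x := by
  funext x
  simp only [birthGenerator, nablaPlus, Set.indicator_apply, Set.mem_ofPred_eq,
    Set.mem_singleton_iff, Pi.one_apply]
  rcases lt_trichotomy x y with h | h | h
  · rw [if_pos (by omega), if_pos (by omega), if_neg (by omega)]; ring
  · subst h
    rw [if_neg (by omega), if_pos (by omega), if_pos rfl]; ring
  · rw [if_neg (by omega), if_neg (by omega), if_neg (by omega)]; ring

/-- `L e^{tL} 1_{⟦0, y⟧} = -λ(y) e^{tL} 1_{y}`. -/
theorem birthGenerator_birthCumul (hlam : UniformlyBounded lam) (t : ℝ) (x y : ℕ) :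
    birthGenerator lam (fun u => birthCumul lam t u y) x = -lam y * birthDensity lam t x y := by
  unfold birthCumul birthDensity
  rw [birthGenerator_birthSemigroup hlam (abs_indicator_one_le _), birthGenerator_indicator_Iic,
    birthSemigroup_const_mul]

theorem hasDerivAt_birthDensity (hlam : UniformlyBounded lam) (t : ℝ) (x y : ℕ) :
    HasDerivAt (fun r => birthDensity lam r x y)
      (birthGenerator lam (fun u => birthDensity lam t u y) x) t := by
  unfold birthDensity
  rw [birthGenerator_birthSemigroup hlam (abs_indicator_one_le _)]
  exact hasDerivAt_birthSemigroup hlam (abs_indicator_one_le _) t x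

theorem hasDerivAt_birthCumul (hlam : UniformlyBounded lam) (t : ℝ) (x : ℕ) (y : ℤ) :
    HasDerivAt (fun r => birthCumul lam r x y)
      (birthGenerator lam (fun u => birthCumul lam t u y) x) t := by
  unfold birthCumul
  rw [birthGenerator_birthSemigroup hlam (abs_indicator_one_le _)]
  exact hasDerivAt_birthSemigroup hlam (abs_indicator_one_le _) t x

theorem hasDerivAt_birthGenerator_birthDensity (hlam : UniformlyBounded lam)
    (t : ℝ) (x y : ℕ) :
    HasDerivAt (fun r => birthGenerator lam (fun u => birthDensity lam r u y) x)
      (birthGenerator lam (birthGenerator lam fun u => birthDensity lam t u y) x) t :=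
  ((hasDerivAt_birthDensity hlam t (x + 1) y).sub
    (hasDerivAt_birthDensity hlam t x y)).const_mul (lam x)

/-- Turns the block `C_t` into `-L` applied to the transition density. The difference is taken on
`ℤ`, so that for `y = 0` the value at `-1` is that of the empty set. -/
theorem nablaMinus_birthCumul (hlam : UniformlyBounded lam) (t : ℝ) (x y : ℕ) :
    nablaMinus (fun v => birthCumul lam t x v) y = -birthDensity lam t x y := by
  have h := birthSemigroup_add hlam
    (abs_indicator_one_le {k : ℕ | (k : ℤ) ≤ (y : ℤ) - 1}) (abs_indicator_one_le {y}) t x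
  have h2 : (fun u : ℕ => {k : ℕ | (k : ℤ) ≤ (y : ℤ) - 1}.indicator (1 : ℕ → ℝ) u +
      Set.indicator {y} 1 u) = {k : ℕ | (k : ℤ) ≤ (y : ℤ)}.indicator 1 := by
    funext u
    simp only [Set.indicator_apply, Set.mem_ofPred_eq, Set.mem_singleton_iff, Pi.one_apply]
    split_ifs <;> first | (exfalso; omega) | norm_num
  rw [h2] at h
  simp only [nablaMinus, birthCumul, birthDensity]
  linarith

end TwoLevel

/-! ### The block determinant kernel and the backward equation -/

theorem Matrix.hasDerivAt_det {n : Type*} [Fintype n] [DecidableEq n] {M : ℝ → Matrix n n ℝ}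
    {M' : Matrix n n ℝ} {t : ℝ} (h : ∀ i j, HasDerivAt (fun r => M r i j) (M' i j) t) :
    HasDerivAt (fun r => (M r).det) (∑ i, ((M t).updateRow i (M' i)).det) t := by
  -- After transposing, the Leibniz formula runs over entries `M i (σ i)`, so differentiating the
  -- `i`-th factor affects row `i` only.
  simp only [← Matrix.det_transpose (M _), ← Matrix.det_transpose (Matrix.updateRow _ _ _)]
  simp only [Matrix.det_apply']
  have key : HasDerivAt (fun r => ∑ σ : Equiv.Perm n,
      ((Equiv.Perm.sign σ : ℤ) : ℝ) * ∏ i, (M r).transpose (σ i) i)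
      (∑ σ : Equiv.Perm n, ((Equiv.Perm.sign σ : ℤ) : ℝ) *
        ∑ i, (∏ j ∈ Finset.univ.erase i, (M t).transpose (σ j) j) • M' i (σ i)) t :=
    HasDerivAt.fun_sum fun σ _ => HasDerivAt.const_mul _
      (HasDerivAt.fun_finsetProd fun i _ => h i (σ i))
  refine key.congr_deriv ?_
  rw [Finset.sum_comm]
  refine Finset.sum_congr rfl fun σ _ => ?_
  rw [Finset.mul_sum]
  refine Finset.sum_congr rfl fun i _ => ?_
  congr 1
  rw [← Finset.mul_prod_erase _ _ (Finset.mem_univ i), smul_eq_mul, mul_comm]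
  congr 1
  · simp
  · refine Finset.prod_congr rfl fun j hj => ?_
    rw [Matrix.transpose_apply, Matrix.transpose_apply,
      Matrix.updateRow_ne (Finset.ne_of_mem_erase hj)]

theorem Matrix.abs_det_le {n : Type*} [Fintype n] [DecidableEq n] {M : Matrix n n ℝ} {K : ℝ}
    (h : ∀ i j, |M i j| ≤ K) :
    |M.det| ≤ (Fintype.card n).factorial * K ^ Fintype.card n := by
  have := Matrix.det_le (A := M) (abv := AbsoluteValue.abs) h
  simpa [nsmul_eq_mul] using this

namespace TwoLevel

variable {lam : ℕ → ℝ} {N : ℕ}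

/-- The row of the block matrix that belongs to an `X`-particle with index `i` at `u`. -/
noncomputable def rowX (lam : ℕ → ℝ) (t : ℝ) (z' : State N) (i : Fin (N + 1)) (u : ℕ) :
    Fin (N + 1) ⊕ Fin N → ℝ :=
  Sum.elim (fun j => birthDensity lam t u (z'.x j))
    (fun j => (lam (z'.y j))⁻¹ *
      (birthCumul lam t u (z'.y j) - if (i : ℕ) ≤ (j : ℕ) then 1 else 0))

/-- The row of the block matrix that belongs to a `Y`-particle at `u`. -/
noncomputable def rowY (lam : ℕ → ℝ) (t : ℝ) (z' : State N) (u : ℕ) :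
    Fin (N + 1) ⊕ Fin N → ℝ :=
  Sum.elim (fun j => -birthGenerator lam (fun v => birthDensity lam t v (z'.x j)) u)
    (fun j => birthDensity lam t u (z'.y j))

/-- The block matrix for arbitrary positions `y` and `x` of the particles. -/
noncomputable def posMatrix (lam : ℕ → ℝ) (t : ℝ) (z' : State N) (y : Fin N → ℕ)
    (x : Fin (N + 1) → ℕ) : Matrix (Fin (N + 1) ⊕ Fin N) (Fin (N + 1) ⊕ Fin N) ℝ :=
  Matrix.of (Sum.elim (fun i => rowX lam t z' i (x i)) (fun i => rowY lam t z' (y i)))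

theorem kernelU_eq_det_posMatrix (hlam : UniformlyBounded lam) (t : ℝ) (z z' : State N) :
    kernelU lam t z z' = (posMatrix lam t z' z.y z.x).det := by
  unfold kernelU
  congr 1
  ext (i | i) (j | j)
  · rfl
  · rfl
  · simp only [Matrix.fromBlocks_apply₂₁, blockC, Matrix.of_apply, nablaMinus_birthCumul hlam,
      posMatrix, Sum.elim_inr, rowY, Sum.elim_inl, birthGenerator, nablaPlus]
    ring
  · rfl

theorem posMatrix_update_x (t : ℝ) (z' : State N) (y : Fin N → ℕ) (x : Fin (N + 1) → ℕ)
    (i : Fin (N + 1)) (u : ℕ) :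
    posMatrix lam t z' y (Function.update x i u) =
      (posMatrix lam t z' y x).updateRow (Sum.inl i) (rowX lam t z' i u) := by
  ext (k | k) j
  · by_cases hk : k = i
    · subst hk; simp [posMatrix]
    · rw [Matrix.updateRow_ne (by simpa using hk)]
      simp [posMatrix, Function.update_of_ne hk]
  · rw [Matrix.updateRow_ne (by simp)]
    rfl

theorem posMatrix_update_y (t : ℝ) (z' : State N) (y : Fin N → ℕ) (x : Fin (N + 1) → ℕ)
    (i : Fin N) (u : ℕ) :
    posMatrix lam t z' (Function.update y i u) x =
      (posMatrix lam t z' y x).updateRow (Sum.inr i) (rowY lam t z' u) := by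
  ext (k | k) j
  · rw [Matrix.updateRow_ne (by simp)]
    rfl
  · by_cases hk : k = i
    · subst hk; simp [posMatrix]
    · rw [Matrix.updateRow_ne (by simpa using hk)]
      simp [posMatrix, Function.update_of_ne hk]

theorem hasDerivAt_rowX (hlam : UniformlyBounded lam) (t : ℝ) (z' : State N) (i : Fin (N + 1))
    (u : ℕ) (j : Fin (N + 1) ⊕ Fin N) :
    HasDerivAt (fun r => rowX lam r z' i u j)
      (lam u * (rowX lam t z' i (u + 1) j - rowX lam t z' i u j)) t := by
  rcases j with j | j
  · exact hasDerivAt_birthDensity hlam t u (z'.x j)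
  · refine (((hasDerivAt_birthCumul hlam t u (z'.y j)).sub_const _).const_mul _).congr_deriv ?_
    simp only [birthGenerator, nablaPlus, rowX, Sum.elim_inr]
    ring

theorem hasDerivAt_rowY (hlam : UniformlyBounded lam) (t : ℝ) (z' : State N)
    (u : ℕ) (j : Fin (N + 1) ⊕ Fin N) :
    HasDerivAt (fun r => rowY lam r z' u j)
      (lam u * (rowY lam t z' (u + 1) j - rowY lam t z' u j)) t := by
  rcases j with j | j
  · refine (hasDerivAt_birthGenerator_birthDensity hlam t u (z'.x j)).neg.congr_deriv ?_
    rw [birthGenerator]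
    simp only [nablaPlus, rowY, Sum.elim_inl]
    ring
  · exact hasDerivAt_birthDensity hlam t u (z'.y j)

theorem det_updateRow_smul_sub {n : Type*} [Fintype n] [DecidableEq n] (M : Matrix n n ℝ) (i : n)
    (c : ℝ) (u v : n → ℝ) :
    (M.updateRow i fun j => c * (u j - v j)).det =
      c * ((M.updateRow i u).det - (M.updateRow i v).det) := by
  have h : (fun j => c * (u j - v j)) = c • (u + (-1 : ℝ) • v) := by
    funext j
    simp only [Pi.smul_apply, Pi.add_apply, smul_eq_mul]
    ring
  rw [h, Matrix.det_updateRow_smul, Matrix.det_updateRow_add, Matrix.det_updateRow_smul]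
  ring

/-- The free evolution: differentiating one row amounts to applying the one-particle generator to
the position of that particle. Interlacing plays no role. -/
theorem hasDerivAt_det_posMatrix (hlam : UniformlyBounded lam) (t : ℝ) (z' : State N)
    (y : Fin N → ℕ) (x : Fin (N + 1) → ℕ) :
    HasDerivAt (fun r => (posMatrix lam r z' y x).det)
      ((∑ i, lam (y i) * ((posMatrix lam t z' (Function.update y i (y i + 1)) x).det -
          (posMatrix lam t z' y x).det)) +
        ∑ i, lam (x i) * ((posMatrix lam t z' y (Function.update x i (x i + 1))).det -
          (posMatrix lam t z' y x).det)) t := by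
  have h := Matrix.hasDerivAt_det (M := fun r => posMatrix lam r z' y x) (t := t)
    (M' := Matrix.of (Sum.elim
      (fun i j => lam (x i) * (rowX lam t z' i (x i + 1) j - rowX lam t z' i (x i) j))
      (fun i j => lam (y i) * (rowY lam t z' (y i + 1) j - rowY lam t z' (y i) j)))) (by
    rintro (i | i) j
    · exact hasDerivAt_rowX hlam t z' i (x i) j
    · exact hasDerivAt_rowY hlam t z' (y i) j)
  refine h.congr_deriv ?_
  rw [Fintype.sum_sum_type, add_comm]
  refine congrArg₂ _ (Finset.sum_congr rfl fun i _ => ?_) (Finset.sum_congr rfl fun i _ => ?_)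
  · rw [posMatrix_update_y]
    refine (det_updateRow_smul_sub _ _ _ _ _).trans ?_
    rw [show rowY lam t z' (y i) = posMatrix lam t z' y x (Sum.inr i) from rfl,
      Matrix.updateRow_eq_self]
  · rw [posMatrix_update_x]
    refine (det_updateRow_smul_sub _ _ _ _ _).trans ?_
    rw [show rowX lam t z' i (x i) = posMatrix lam t z' y x (Sum.inl i) from rfl,
      Matrix.updateRow_eq_self]

/-- In the left half this is the definition of `L`. In the right half it is
`birthGenerator_birthCumul`: the normalisation `λ(y'_j)⁻¹` cancels the factor it produces, and the
indicator of `i ≤ j` drops out because it does not depend on `u`. -/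
theorem rowX_succ (hlam : UniformlyBounded lam) (t : ℝ) (z' : State N) (i : Fin (N + 1)) (u : ℕ) :
    rowX lam t z' i (u + 1) = rowX lam t z' i u + (-(lam u)⁻¹) • rowY lam t z' u := by
  have hu := (hlam.pos u).ne'
  funext j
  rcases j with j | j
  · simp only [rowX, rowY, Sum.elim_inl, Pi.add_apply, Pi.smul_apply, smul_eq_mul, birthGenerator,
      nablaPlus]
    field_simp
    ring
  · have hv := (hlam.pos (z'.y j)).ne'
    have h := birthGenerator_birthCumul hlam t u (z'.y j)
    simp only [birthGenerator, nablaPlus] at h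
    simp only [rowX, rowY, Sum.elim_inr, Pi.add_apply, Pi.smul_apply, smul_eq_mul]
    have h1 : birthCumul lam t (u + 1) (z'.y j) = birthCumul lam t u (z'.y j) -
        (lam u)⁻¹ * (lam (z'.y j) * birthDensity lam t u (z'.y j)) := by
      field_simp
      linarith
    rw [h1]
    field_simp
    ring

/-! ### Boundary conditions: blocking, pushing and killing -/

/-- By `rowX_succ` the jump adds a multiple of the row of `y_k` to the row of `x_i`. Read from left
to right this is blocking, from right to left pushing. -/
theorem det_posMatrix_update_x_of_eq (hlam : UniformlyBounded lam) (t : ℝ) (z' : State N)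
    (y : Fin N → ℕ) (x : Fin (N + 1) → ℕ) {i : Fin (N + 1)} {k : Fin N} (h : x i = y k) :
    (posMatrix lam t z' y (Function.update x i (x i + 1))).det = (posMatrix lam t z' y x).det := by
  rw [posMatrix_update_x, rowX_succ hlam,
    show rowX lam t z' i (x i) = posMatrix lam t z' y x (Sum.inl i) from rfl, h,
    show rowY lam t z' (y k) = posMatrix lam t z' y x (Sum.inr k) from rfl,
    Matrix.det_updateRow_add_smul_self _ (by simp)]

theorem det_posMatrix_of_eq (t : ℝ) (z' : State N)
    (y : Fin N → ℕ) (x : Fin (N + 1) → ℕ) {i k : Fin N} (hik : i ≠ k) (h : y i = y k) :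
    (posMatrix lam t z' y x).det = 0 := by
  refine Matrix.det_zero_of_row_eq (i := Sum.inr i) (j := Sum.inr k) (by simpa using hik) ?_
  exact congrArg (rowY lam t z') h

theorem kernelU_ringX (hlam : UniformlyBounded lam) (t : ℝ) (z z' : State N) (i : Fin (N + 1)) :
    kernelU lam t (z.ringX i) z' =
      (posMatrix lam t z' z.y (Function.update z.x i (z.x i + 1))).det := by
  unfold State.ringX
  split_ifs with h
  · exact kernelU_eq_det_posMatrix hlam t _ z'
  · rw [kernelU_eq_det_posMatrix hlam]
    rw [Interlaces, not_forall] at h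
    obtain ⟨k, hk⟩ := h
    have hi := z.interlaces k
    -- Moving an `X`-particle to the right can only violate `x_k ≤ y_k`; the upper constraint `y_k <
    -- x_{k+1}` is preserved.
    have : i = k.castSucc := by
      by_contra hne
      refine hk ?_
      rw [Function.update_of_ne (Ne.symm hne)]
      refine ⟨hi.1, hi.2.trans_le ?_⟩
      by_cases hs : k.succ = i
      · rw [hs, Function.update_self]; omega
      · rw [Function.update_of_ne hs]
    subst this
    refine (det_posMatrix_update_x_of_eq hlam t z' _ _ (k := k) ?_).symm
    rw [Function.update_self, Function.update_of_ne (Fin.castSucc_lt_succ (i := k)).ne'] at hk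
    omega

/-- A collision gives two equal rows, matching the value `0` at the cemetery. In the pushing case
the moved `Y`-particle sits at `x_{i+1}`, so the push does not change the determinant. -/
theorem kernelU_ringY (hlam : UniformlyBounded lam) (t : ℝ) (z z' : State N) (i : Fin N) :
    ((z.ringY i).elim 0 fun w => kernelU lam t w z') =
      (posMatrix lam t z' (Function.update z.y i (z.y i + 1)) z.x).det := by
  unfold State.ringY
  split_ifs with h
  · obtain ⟨j, hj⟩ := h
    have hij : i ≠ j := by rintro rfl; omega
    refine (det_posMatrix_of_eq t z' _ _ hij ?_).symm
    rw [Function.update_self, Function.update_of_ne hij.symm, hj]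
  · refine (kernelU_eq_det_posMatrix hlam t _ z').trans ?_
    simp only [State.pushedX]
    split_ifs with hp
    · rfl
    · refine det_posMatrix_update_x_of_eq hlam t z' _ _ (k := i) ?_
      rw [Function.update_self]
      have := z.interlaces i
      omega

/-- The Kolmogorov backward equation. -/
theorem hasDerivAt_kernelU (hlam : UniformlyBounded lam) (t : ℝ) (z z' : State N) :
    HasDerivAt (fun r => kernelU lam r z z') (generator lam (fun w => kernelU lam t w z') z) t := by
  have h := hasDerivAt_det_posMatrix hlam t z' z.y z.x
  simp only [← kernelU_ringX hlam, ← kernelU_ringY hlam, ← kernelU_eq_det_posMatrix hlam] at h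
  refine h.congr_deriv ?_
  rw [generator, Fintype.sum_sum_type]
  rfl

/-- The uniformity in the states is what the uniqueness argument for the renewal equation requires.
All entries are bounded because `λ` and `λ⁻¹` are. -/
theorem exists_abs_kernelU_le (hlam : UniformlyBounded lam) (T : ℝ) :
    ∃ K, 0 ≤ K ∧ ∀ t, 0 ≤ t → t ≤ T → ∀ z z' : State N, |kernelU lam t z z'| ≤ K := by
  obtain ⟨M, hM0, hM⟩ := hlam.exists_le
  obtain ⟨m, hm0, hm⟩ := hlam.exists_inv_le
  set E := Real.exp (|T| * (2 * M)) * 1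
  have hS : ∀ t, 0 ≤ t → t ≤ T → ∀ (s : Set ℕ) (x : ℕ),
      |birthSemigroup lam t (s.indicator 1) x| ≤ E := by
    intro t h0 ht s x
    refine (abs_birthSemigroup_le hlam hM (abs_indicator_one_le s) t x).trans ?_
    have : |t| ≤ |T| := abs_le_abs_of_nonneg h0 ht
    simp only [E]
    gcongr
  have hE : 1 ≤ E := by
    simp only [E, mul_one]
    exact Real.one_le_exp (by positivity)
  -- The sum of the entry bounds for `B_t`, for `C_t`, and for `A_t` and `D_t`.
  set K := m * (E + 1) + M * (E + E) + E
  have hK1 : m * (E + 1) ≤ K := by simp only [K]; nlinarith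
  have hK2 : M * (E + E) ≤ K := by simp only [K]; nlinarith
  have hK3 : E ≤ K := by simp only [K]; nlinarith
  have hK0 : 0 ≤ K := by linarith
  refine ⟨(Fintype.card (Fin (N + 1) ⊕ Fin N)).factorial * K ^ Fintype.card (Fin (N + 1) ⊕ Fin N),
    by positivity, fun t h0 ht z z' => ?_⟩
  rw [kernelU_eq_det_posMatrix hlam]
  refine Matrix.abs_det_le ?_
  rintro (i | i) (j | j)
  · exact (hS t h0 ht _ _).trans hK3
  · refine le_trans ?_ hK1
    simp only [posMatrix, Matrix.of_apply, Sum.elim_inl, rowX, Sum.elim_inr]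
    rw [abs_mul, abs_of_pos (inv_pos.2 (hlam.pos _))]
    refine mul_le_mul (hm _) ((abs_sub _ _).trans (add_le_add (hS t h0 ht _ _) ?_))
      (abs_nonneg _) hm0.le
    split_ifs <;> simp
  · refine le_trans ?_ hK2
    simp only [posMatrix, Matrix.of_apply, Sum.elim_inl, rowY, Sum.elim_inr, birthGenerator,
      nablaPlus]
    rw [abs_neg, abs_mul, abs_of_pos (hlam.pos _)]
    exact mul_le_mul (hM _) ((abs_sub _ _).trans (add_le_add (hS t h0 ht _ _) (hS t h0 ht _ _)))
      (abs_nonneg _) hM0.le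
  · exact (hS t h0 ht _ _).trans hK3

/-! ### The initial condition -/

theorem State.x_strictMono (z : State N) : StrictMono z.x :=
  Fin.strictMono_iff_lt_succ.2 fun i => (z.interlaces i).1.trans_lt (z.interlaces i).2

theorem State.x_le_y (z : State N) {i : Fin (N + 1)} {k : Fin N} (h : (i : ℕ) ≤ k) :
    z.x i ≤ z.y k :=
  (z.x_strictMono.monotone (Fin.le_def.2 h : i ≤ k.castSucc)).trans (z.interlaces k).1

theorem State.y_lt_x (z : State N) {i : Fin (N + 1)} {k : Fin N} (h : (k : ℕ) < i) :
    z.y k < z.x i :=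
  (z.interlaces k).2.trans_le (z.x_strictMono.monotone (Fin.le_def.2 h : k.succ ≤ i))

theorem State.y_strictMono (z : State N) : StrictMono z.y := fun _ k h =>
  (z.y_lt_x (i := k.castSucc) h).trans_le (z.x_le_y le_rfl)

/-- The order of an `X`- and a `Y`-particle is decided by their indices. Hence the indicator of `i ≤
j` subtracted in `B_t` is exactly its value at time `0` on an interlacing state. -/
theorem State.x_le_y_iff (z : State N) {i : Fin (N + 1)} {k : Fin N} :
    z.x i ≤ z.y k ↔ (i : ℕ) ≤ k :=
  ⟨fun h => not_lt.1 fun h' => (z.y_lt_x h').not_ge h, z.x_le_y⟩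

section zero

variable (z z' : State N)

theorem posMatrix_zero_inl_inl (i j : Fin (N + 1)) :
    posMatrix lam 0 z' z.y z.x (Sum.inl i) (Sum.inl j) = if z.x i = z'.x j then 1 else 0 :=
  birthDensity_zero _ _

theorem posMatrix_zero_inl_inr (i : Fin (N + 1)) (j : Fin N) :
    posMatrix lam 0 z' z.y z.x (Sum.inl i) (Sum.inr j) =
      (lam (z'.y j))⁻¹ * ((if z.x i ≤ z'.y j then 1 else 0) -
        if (i : ℕ) ≤ (j : ℕ) then 1 else 0) := by
  rw [← birthCumul_zero (lam := lam)]
  rfl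

theorem posMatrix_zero_inr_inl (i : Fin N) (j : Fin (N + 1)) :
    posMatrix lam 0 z' z.y z.x (Sum.inr i) (Sum.inl j) =
      -(lam (z.y i) * ((if z.y i + 1 = z'.x j then 1 else 0) -
        if z.y i = z'.x j then 1 else 0)) := by
  rw [← birthDensity_zero (lam := lam), ← birthDensity_zero (lam := lam)]
  rfl

theorem posMatrix_zero_inr_inr (i j : Fin N) :
    posMatrix lam 0 z' z.y z.x (Sum.inr i) (Sum.inr j) = if z.y i = z'.y j then 1 else 0 :=
  birthDensity_zero _ _

variable {z z'}

/-- An entry of the upper right block vanishes if `x_i` lies on the same side of `y'_j` as in an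
interlacing configuration. -/
theorem posMatrix_zero_inl_inr_eq_zero {i : Fin (N + 1)} {j : Fin N}
    (h : z.x i ≤ z'.y j ↔ (i : ℕ) ≤ j) :
    posMatrix lam 0 z' z.y z.x (Sum.inl i) (Sum.inr j) = 0 := by
  rw [posMatrix_zero_inl_inr]
  by_cases hij : (i : ℕ) ≤ j
  · rw [if_pos hij, if_pos (h.2 hij)]; ring
  · rw [if_neg hij, if_neg (mt h.1 hij)]; ring

theorem posMatrix_zero_inr_inl_eq_zero {i : Fin N} {j : Fin (N + 1)}
    (h1 : z.y i + 1 ≠ z'.x j) (h2 : z.y i ≠ z'.x j) :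
    posMatrix lam 0 z' z.y z.x (Sum.inr i) (Sum.inl j) = 0 := by
  rw [posMatrix_zero_inr_inl, if_neg h1, if_neg h2]; ring

theorem posMatrix_zero_inl_inl_eq_zero {i j : Fin (N + 1)} (h : z.x i ≠ z'.x j) :
    posMatrix lam 0 z' z.y z.x (Sum.inl i) (Sum.inl j) = 0 := by
  rw [posMatrix_zero_inl_inl, if_neg h]

theorem posMatrix_zero_inr_inr_eq_zero {i j : Fin N} (h : z.y i ≠ z'.y j) :
    posMatrix lam 0 z' z.y z.x (Sum.inr i) (Sum.inr j) = 0 := by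
  rw [posMatrix_zero_inr_inr, if_neg h]

/-- If all the entries of column `a` vanish outside row `r`, and column `b ≠ a` has this property
too, then the determinant vanishes. -/
theorem det_eq_zero_of_two_cols {n : Type*} [Fintype n] [DecidableEq n] {M : Matrix n n ℝ}
    {r a b : n} (hab : a ≠ b) (ha : ∀ i, i ≠ r → M i a = 0) (hb : ∀ i, i ≠ r → M i b = 0) :
    M.det = 0 := by
  rw [Matrix.det_apply']
  refine Finset.sum_eq_zero fun σ _ => ?_
  by_cases h : σ a = r
  · have h' : σ b ≠ r := fun e => hab (σ.injective (h.trans e.symm))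
    exact mul_eq_zero_of_right _ (Finset.prod_eq_zero (Finset.mem_univ b) (hb _ h'))
  · exact mul_eq_zero_of_right _ (Finset.prod_eq_zero (Finset.mem_univ a) (ha _ h))

theorem det_eq_zero_of_two_rows {n : Type*} [Fintype n] [DecidableEq n] {M : Matrix n n ℝ}
    {c a b : n} (hab : a ≠ b) (ha : ∀ j, j ≠ c → M a j = 0) (hb : ∀ j, j ≠ c → M b j = 0) :
    M.det = 0 := by
  rw [← Matrix.det_transpose]
  exact det_eq_zero_of_two_cols hab ha hb

/-- If `x_i < x'_i`, the row of `x_i` vanishes. If `x_i > x'_i`, the column of `x'_i` can be nonzero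
only in the row of the preceding `Y`-particle, where `y + 1 = x'_i` is possible; since that particle
already agrees with its target, the column of the target lives in the same row. For the first
`X`-particle the column vanishes. -/
theorem x_eq_of_det_posMatrix_ne_zero (i : Fin (N + 1))
    (hdet : (posMatrix lam 0 z' z.y z.x).det ≠ 0)
    (hx : ∀ k : Fin (N + 1), k < i → z.x k = z'.x k)
    (hy : ∀ k : Fin N, (k : ℕ) < i → z.y k = z'.y k) : z.x i = z'.x i := by
  by_contra hne
  refine hdet ?_
  rcases lt_or_gt_of_ne hne with h | h
  · refine Matrix.det_eq_zero_of_row_eq_zero (Sum.inl i) ?_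
    rintro (j | j)
    · refine posMatrix_zero_inl_inl_eq_zero ?_
      rcases lt_or_ge j i with hj | hj
      · rw [← hx j hj]
        exact (z.x_strictMono hj).ne'
      · exact (h.trans_le (z'.x_strictMono.monotone hj)).ne
    · refine posMatrix_zero_inl_inr_eq_zero ?_
      rcases lt_or_ge (j : ℕ) i with hj | hj
      · rw [← hy j hj]
        exact z.x_le_y_iff
      · have := z'.x_le_y hj
        constructor <;> intro <;> omega
  · have hrow : ∀ k : Fin N, (k : ℕ) + 1 ≠ i →
        posMatrix lam 0 z' z.y z.x (Sum.inr k) (Sum.inl i) = 0 := by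
      intro k hk
      rcases lt_or_ge (k : ℕ) i with hki | hki
      · have h1 := z'.interlaces k
        have h2 := z'.x_strictMono (Fin.lt_def.2 (by simp; omega) : k.succ < i)
        have h3 := hy k hki
        exact posMatrix_zero_inr_inl_eq_zero (by omega) (by omega)
      · have h1 := z.x_le_y hki
        exact posMatrix_zero_inr_inl_eq_zero (by omega) (by omega)
    have hrow' : ∀ k, posMatrix lam 0 z' z.y z.x (Sum.inl k) (Sum.inl i) = 0 := by
      intro k
      refine posMatrix_zero_inl_inl_eq_zero ?_
      rcases lt_or_ge k i with hk | hk
      · rw [hx k hk]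
        exact (z'.x_strictMono hk).ne
      · exact (h.trans_le (z.x_strictMono.monotone hk)).ne'
    rcases Fin.eq_zero_or_eq_succ i with rfl | ⟨p, rfl⟩
    · refine Matrix.det_eq_zero_of_column_eq_zero (Sum.inl 0) ?_
      rintro (k | k)
      · exact hrow' k
      · exact hrow k (by simp)
    · have hp := hy p (by simp)
      refine det_eq_zero_of_two_cols (r := Sum.inr p) (a := Sum.inl p.succ) (b := Sum.inr p)
        (by simp) ?_ ?_
      · rintro (k | k) hk
        · exact hrow' k
        · exact hrow k fun e => hk (congrArg Sum.inr (Fin.ext (by simpa using e)))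
      · rintro (k | k) hk
        · refine posMatrix_zero_inl_inr_eq_zero ?_
          rw [← hp]
          exact z.x_le_y_iff
        · refine posMatrix_zero_inr_inr_eq_zero ?_
          rw [← hp]
          exact fun e => hk (congrArg Sum.inr (z.y_strictMono.injective e))

/-- If `y_i < y'_i`, the rows of `x_i` and `y_i` are both supported in the column of `x'_i`. If `y_i
> y'_i`, the column of `y'_i` vanishes. -/
theorem y_eq_of_det_posMatrix_ne_zero (i : Fin N)
    (hdet : (posMatrix lam 0 z' z.y z.x).det ≠ 0)
    (hx : ∀ k : Fin (N + 1), (k : ℕ) ≤ i → z.x k = z'.x k)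
    (hy : ∀ k : Fin N, k < i → z.y k = z'.y k) : z.y i = z'.y i := by
  by_contra hne
  refine hdet ?_
  rcases lt_or_gt_of_ne hne with h | h
  · refine det_eq_zero_of_two_rows (c := Sum.inl i.castSucc) (a := Sum.inl i.castSucc)
      (b := Sum.inr i) (by simp) ?_ ?_
    · rintro (j | j) hj
      · refine posMatrix_zero_inl_inl_eq_zero ?_
        rw [hx i.castSucc (by simp)]
        exact fun e => hj (congrArg Sum.inl (z'.x_strictMono.injective e).symm)
      · refine posMatrix_zero_inl_inr_eq_zero ?_
        rw [hx i.castSucc (by simp)]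
        exact z'.x_le_y_iff
    · rintro (j | j) hj
      · rcases lt_trichotomy (j : ℕ) i with hji | hji | hji
        · have h1 := z.x_strictMono (Fin.lt_def.2 (by simpa using hji) : j < i.castSucc)
          have h2 := hx j hji.le
          have h3 := (z.interlaces i).1
          exact posMatrix_zero_inr_inl_eq_zero (by omega) (by omega)
        · exact absurd (congrArg Sum.inl (Fin.ext (by simpa using hji))) hj
        · have := z'.y_lt_x hji
          exact posMatrix_zero_inr_inl_eq_zero (by omega) (by omega)
      · refine posMatrix_zero_inr_inr_eq_zero ?_
        rcases lt_or_ge j i with hji | hji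
        · rw [← hy j hji]
          exact (z.y_strictMono hji).ne'
        · exact (h.trans_le (z'.y_strictMono.monotone hji)).ne
  · refine Matrix.det_eq_zero_of_column_eq_zero (Sum.inr i) ?_
    rintro (k | k)
    · refine posMatrix_zero_inl_inr_eq_zero ?_
      rcases le_or_gt (k : ℕ) i with hk | hk
      · rw [hx k hk]
        exact z'.x_le_y_iff
      · have := z.y_lt_x hk
        constructor <;> intro <;> omega
    · refine posMatrix_zero_inr_inr_eq_zero ?_
      rcases lt_or_ge k i with hki | hki
      · rw [hy k hki]
        exact (z'.y_strictMono hki).ne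
      · exact (h.trans_le (z.y_strictMono.monotone hki)).ne'

theorem eq_of_det_posMatrix_ne_zero (hdet : (posMatrix lam 0 z' z.y z.x).det ≠ 0) : z = z' := by
  -- Induction along `x_1, y_1, x_2, …`: at each level the `X`-particle is settled before the
  -- `Y`-particle with the same index.
  have key : ∀ n : ℕ, (∀ i : Fin (N + 1), (i : ℕ) < n → z.x i = z'.x i) ∧
      ∀ i : Fin N, (i : ℕ) < n → z.y i = z'.y i := by
    intro n
    induction n with
    | zero => simp
    | succ n ih =>
      have hx : ∀ i : Fin (N + 1), (i : ℕ) < n + 1 → z.x i = z'.x i := fun i hi =>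
        x_eq_of_det_posMatrix_ne_zero i hdet (fun k hk => ih.1 k (by have := Fin.lt_def.1 hk; omega))
          (fun k hk => ih.2 k (by omega))
      exact ⟨hx, fun i hi => y_eq_of_det_posMatrix_ne_zero i hdet (fun k hk => hx k (by omega))
        (fun k hk => ih.2 k (by have := Fin.lt_def.1 hk; omega))⟩
  exact State.ext (funext fun i => (key (i + 1)).2 i (by omega))
    (funext fun i => (key (i + 1)).1 i (by omega))

end zero

theorem kernelU_zero_self (hlam : UniformlyBounded lam) (z : State N) : kernelU lam 0 z z = 1 := by
  rw [kernelU_eq_det_posMatrix hlam, ← Matrix.fromBlocks_toBlocks (posMatrix lam 0 z z.y z.x)]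
  have hB : (posMatrix lam 0 z z.y z.x).toBlocks₁₂ = 0 := by
    ext i j
    exact posMatrix_zero_inl_inr_eq_zero z.x_le_y_iff
  have hA : (posMatrix lam 0 z z.y z.x).toBlocks₁₁ = 1 := by
    ext i j
    refine (posMatrix_zero_inl_inl z z i j).trans ?_
    simp only [z.x_strictMono.injective.eq_iff, Matrix.one_apply]
  have hD : (posMatrix lam 0 z z.y z.x).toBlocks₂₂ = 1 := by
    ext i j
    refine (posMatrix_zero_inr_inr z z i j).trans ?_
    simp only [z.y_strictMono.injective.eq_iff, Matrix.one_apply]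
  rw [hB, Matrix.det_fromBlocks_zero₁₂, hA, hD, Matrix.det_one, Matrix.det_one, one_mul]

theorem kernelU_zero_of_ne (hlam : UniformlyBounded lam) {z z' : State N} (h : z ≠ z') :
    kernelU lam 0 z z' = 0 := by
  rw [kernelU_eq_det_posMatrix hlam]
  by_contra hne
  exact h (eq_of_det_posMatrix_ne_zero hne)

end TwoLevel

section

open MeasureTheory ProbabilityTheory

/-! ### Competing exponential clocks -/

theorem lintegral_expMeasure {r : ℝ} {f : ℝ → ENNReal} (hf : Measurable f) :
    ∫⁻ x, f x ∂expMeasure r =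
      ∫⁻ x in Set.Ioi 0, ENNReal.ofReal (r * Real.exp (-(r * x))) * f x := by
  have hm : Measurable (exponentialPDF r) := (measurable_exponentialPDFReal r).ennreal_ofReal
  rw [show expMeasure r = volume.withDensity (exponentialPDF r) from rfl,
    lintegral_withDensity_eq_lintegral_mul _ hm hf, setLIntegral_congr Ioi_ae_eq_Ici,
    ← lintegral_indicator measurableSet_Ici]
  refine lintegral_congr fun x => ?_
  by_cases hx : 0 ≤ x
  · rw [Set.indicator_of_mem (Set.mem_Ici.2 hx), Pi.mul_apply, exponentialPDF_of_nonneg hx]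
  · rw [Set.indicator_of_notMem (by simpa using hx), Pi.mul_apply,
      exponentialPDF_of_neg (not_le.1 hx), zero_mul]

theorem expMeasure_Ioi {r : ℝ} (hr : 0 < r) {u : ℝ} (hu : 0 ≤ u) :
    expMeasure r (Set.Ioi u) = ENNReal.ofReal (Real.exp (-(r * u))) := by
  have := isProbabilityMeasure_expMeasure hr
  have h := cdf_expMeasure_eq hr u
  rw [if_pos hu, cdf_eq_real] at h
  have h2 := probReal_compl_eq_one_sub (μ := expMeasure r) (measurableSet_Iic (a := u))
  rw [h, Set.compl_Iic] at h2
  rw [← ofReal_measureReal, h2]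
  congr 1
  ring

theorem lintegral_Ioi_zero_comp_mul {c : ℝ} (hc : 0 < c) {g : ℝ → ENNReal} (hg : Measurable g) :
    ∫⁻ u in Set.Ioi 0, g u = ∫⁻ r in Set.Ioi 0, ENNReal.ofReal c * g (c * r) := by
  conv_lhs => rw [← Real.smul_map_volume_mul_left hc.ne']
  rw [Measure.restrict_smul, lintegral_smul_measure,
    setLIntegral_map measurableSet_Ioi hg (measurable_const_mul c), abs_of_pos hc,
    lintegral_const_mul _ (by fun_prop), smul_eq_mul]
  congr 3
  ext r
  simp [hc]

section clocks

variable {α : Type*} [Fintype α] {c : α → ℝ}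

/-- The law of the time of the first ring on the event that it comes from the clock `a`. -/
theorem lintegral_strictMin (hc : ∀ a, 0 < c a) (a : α) {F : ℝ → ENNReal} (hF : Measurable F) :
    ∫⁻ ε, {ε : α → ℝ | ∀ b, b ≠ a → ε a / c a < ε b / c b}.indicator (fun ε => F (ε a / c a)) ε
        ∂Measure.pi (fun _ : α => expMeasure 1) =
      ∫⁻ r in Set.Ioi 0, ENNReal.ofReal (c a * Real.exp (-((∑ b, c b) * r))) * F r := by
  classical
  have := isProbabilityMeasure_expMeasure one_pos
  set e1 := MeasurableEquiv.piEquivPiSubtypeProd (fun _ : α => ℝ) (fun b => b = a)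
  have hmp := measurePreserving_piEquivPiSubtypeProd (fun _ : α => expMeasure 1) (fun b => b = a)
  set G : ({b // b = a} → ℝ) × ({b // ¬ b = a} → ℝ) → ENNReal := fun p =>
    {p : ({b // b = a} → ℝ) × ({b // ¬ b = a} → ℝ) |
      ∀ b, p.1 default / c a < p.2 b / c b}.indicator (fun p => F (p.1 default / c a)) p
  have hset : MeasurableSet {p : ({b // b = a} → ℝ) × ({b // ¬ b = a} → ℝ) |
      ∀ b, p.1 default / c a < p.2 b / c b} := by
    rw [Set.ofPred_forall]
    exact MeasurableSet.iInter fun b => measurableSet_lt (by fun_prop) (by fun_prop)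
  have hG : Measurable G := Measurable.indicator (by fun_prop) hset
  have h1 : ∀ ε, {ε : α → ℝ | ∀ b, b ≠ a → ε a / c a < ε b / c b}.indicator
      (fun ε => F (ε a / c a)) ε = G (e1 ε) := by
    intro ε
    simp only [G, Set.indicator_apply, Set.mem_ofPred_eq, Subtype.forall]
    rfl
  simp only [h1]
  rw [hmp.lintegral_comp hG, lintegral_prod _ hG.aemeasurable]
  have h2 : ∀ p1 : {b // b = a} → ℝ, ∫⁻ p2, G (p1, p2)
      ∂Measure.pi (fun _ : {b // ¬ b = a} => expMeasure 1) =
      (fun u : ℝ => F (u / c a) *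
        ∏ b : {b // ¬ b = a}, expMeasure 1 (Set.Ioi (c b * (u / c a)))) (p1 default) := by
    intro p1
    have : ∀ p2, G (p1, p2) = (Set.pi Set.univ fun b : {b // ¬ b = a} =>
        Set.Ioi (c b * (p1 default / c a))).indicator (fun _ => F (p1 default / c a)) p2 := by
      intro p2
      simp only [G, Set.indicator_apply, Set.mem_ofPred_eq, Set.mem_pi, Set.mem_univ,
        forall_true_left, Set.mem_Ioi]
      congr 1
      refine propext (forall_congr' fun b => ?_)
      rw [lt_div_iff₀ (hc b), mul_comm]
    simp only [this]
    rw [lintegral_indicator (MeasurableSet.univ_pi fun _ => measurableSet_Ioi),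
      setLIntegral_const, Measure.pi_pi]
  simp only [h2]
  set H : ℝ → ENNReal := fun u : ℝ => F (u / c a) *
        ∏ b : {b // ¬ b = a}, expMeasure 1 (Set.Ioi (c b * (u / c a)))
  have hH : Measurable H := by
    refine (hF.comp (measurable_id.div_const _)).mul (Finset.measurable_prod _ fun b _ => ?_)
    have : Antitone fun u : ℝ => expMeasure 1 (Set.Ioi (c b * (u / c a))) := by
      intro u v huv
      refine measure_mono (Set.Ioi_subset_Ioi ?_)
      have := (hc b).le
      have := (hc a).le
      gcongr
    exact this.measurable
  have h3 : ∀ inst : Fintype {b // b = a}, ∫⁻ x : {b // b = a} → ℝ, H (x default)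
      ∂@Measure.pi _ _ inst _ (fun _ => expMeasure 1) = ∫⁻ u, H u ∂expMeasure 1 := by
    intro inst
    rw [← (measurePreserving_funUnique (expMeasure 1) {b // b = a}).lintegral_comp hH]
    congr!
  refine (h3 _).trans ?_
  rw [lintegral_expMeasure hH, lintegral_Ioi_zero_comp_mul (hc a) (by fun_prop)]
  refine setLIntegral_congr_fun measurableSet_Ioi fun r hr => ?_
  have hr0 : 0 ≤ r := le_of_lt hr
  have hca := (hc a).ne'
  simp only [H]
  rw [mul_div_cancel_left₀ _ hca]
  have h4 : ∀ b : {b // ¬ b = a}, expMeasure 1 (Set.Ioi (c b * r)) =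
      ENNReal.ofReal (Real.exp (-(c b * r))) := fun b => by
    rw [expMeasure_Ioi one_pos (mul_nonneg (hc b).le hr0), one_mul]
  simp only [h4]
  rw [← ENNReal.ofReal_prod_of_nonneg (fun b _ => (Real.exp_pos _).le), ← Real.exp_sum,
    mul_comm (F r), ← mul_assoc, ← mul_assoc, ← ENNReal.ofReal_mul (hc a).le,
    ← ENNReal.ofReal_mul (mul_nonneg (hc a).le (by positivity))]
  congr 2
  rw [one_mul, one_mul, mul_assoc, ← Real.exp_add]
  congr 2
  rw [Finset.sum_neg_distrib, ← Finset.sum_mul, ← neg_add, ← add_mul]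
  congr 2
  have h5 : (∑ b : {b // ¬ b = a}, c b) = ∑ b ∈ Finset.univ.erase a, c b := by
    refine (Finset.sum_subtype _ (fun b => ?_) _).symm
    simp
  rw [h5, Finset.add_sum_erase _ _ (Finset.mem_univ a)]

theorem measurableSet_strictMin (a : α) :
    MeasurableSet {ε : α → ℝ | ∀ b, b ≠ a → ε a / c a < ε b / c b} := by
  rw [Set.ofPred_forall]
  refine MeasurableSet.iInter fun b => ?_
  rw [Set.ofPred_forall]
  exact MeasurableSet.iInter fun _ => measurableSet_lt (by fun_prop) (by fun_prop)

/-- The disjoint events of a strict minimum at `a` have densities adding up to that of an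
exponential law of the total rate. Ties are thus null, and the arbitrary choice in `firstRing` is
immaterial. -/
theorem ae_exists_strictMin [Nonempty α] (hc : ∀ a, 0 < c a) :
    ∀ᵐ ε ∂Measure.pi (fun _ : α => expMeasure 1), ∃ a, ∀ b, b ≠ a → ε a / c a < ε b / c b := by
  have := isProbabilityMeasure_expMeasure one_pos
  set P := Measure.pi (fun _ : α => expMeasure 1)
  have hL : 0 < ∑ b, c b := Finset.sum_pos (fun a _ => hc a) Finset.univ_nonempty
  have h1 : ∀ a, P {ε : α → ℝ | ∀ b, b ≠ a → ε a / c a < ε b / c b} =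
      ∫⁻ r in Set.Ioi 0, ENNReal.ofReal (c a * Real.exp (-((∑ b, c b) * r))) := by
    intro a
    have h := lintegral_strictMin hc a (F := fun _ => 1) measurable_const
    rw [lintegral_indicator_const (measurableSet_strictMin a), one_mul] at h
    simpa using h
  have h2 : P (⋃ a, {ε : α → ℝ | ∀ b, b ≠ a → ε a / c a < ε b / c b}) = 1 := by
    rw [measure_iUnion _ measurableSet_strictMin, tsum_fintype]
    · simp only [h1]
      rw [← lintegral_finsetSum _ (fun a _ => by fun_prop)]
      have := isProbabilityMeasure_expMeasure hL
      rw [← measure_univ (μ := expMeasure (∑ b, c b)), ← lintegral_one,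
        lintegral_expMeasure measurable_const]
      refine lintegral_congr fun r => ?_
      rw [mul_one, ← ENNReal.ofReal_sum_of_nonneg
        (fun a _ => mul_nonneg (hc a).le (Real.exp_pos _).le), ← Finset.sum_mul]
    · intro a b hab
      refine Set.disjoint_left.2 fun ε h1 h2 => ?_
      exact lt_asymm (h1 b hab.symm) (h2 a hab)
  have h3 := (prob_compl_eq_zero_iff (MeasurableSet.iUnion measurableSet_strictMin)).2 h2
  filter_upwards [compl_mem_ae_iff.2 h3] with ε hε
  simpa using hε

/-- The joint law of the first ring among independent exponential clocks of rates `c` and of its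
time. -/
theorem lintegral_firstRing [Nonempty α] (hc : ∀ a, 0 < c a) {b : (α → ℝ) → α}
    (hb : ∀ ε a, ε (b ε) / c (b ε) ≤ ε a / c a) {F : α → ℝ → ENNReal}
    (hF : ∀ a, Measurable (F a)) :
    ∫⁻ ε, F (b ε) (ε (b ε) / c (b ε)) ∂Measure.pi (fun _ : α => expMeasure 1) =
      ∑ a, ∫⁻ r in Set.Ioi 0, ENNReal.ofReal (c a * Real.exp (-((∑ b, c b) * r))) * F a r := by
  simp only [← lintegral_strictMin hc _ (hF _)]
  rw [← lintegral_finsetSum _ fun a _ => Measurable.indicator (by fun_prop)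
    (measurableSet_strictMin a)]
  refine lintegral_congr_ae ?_
  filter_upwards [ae_exists_strictMin hc] with ε ⟨a, ha⟩
  have hba : b ε = a := by
    by_contra hne
    exact (hb ε a).not_gt (ha _ hne)
  rw [Finset.sum_eq_single a, hba]
  · exact (Set.indicator_of_mem (s := {ε : α → ℝ | ∀ b, b ≠ a → ε a / c a < ε b / c b}) ha
      (fun ε => F a (ε a / c a))).symm
  · intro a' _ hne
    refine Set.indicator_of_notMem (fun h => ?_) _
    exact lt_asymm (h a hne.symm) (ha a' hne)
  · simp

end clocks

end

namespace TwoLevel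

open MeasureTheory ProbabilityTheory

variable {lam : ℕ → ℝ} {N : ℕ}

/-! ### Decomposition of the dynamics at the first ring -/

/-- The clocks whose first round is `ε` and whose later rounds are `e`. -/
def consClock (ε : Particle N → ℝ) (e : ℕ × Particle N → ℝ) : ℕ × Particle N → ℝ
  | (0, a) => ε a
  | (n + 1, a) => e (n, a)

/-- The state at time `t` of the dynamics started from `z`, if the first ring is that of the clock
of `a` at time `r`, and the later rounds of the clocks are `e`. -/
noncomputable def stepProcess (lam : ℕ → ℝ) (z : State N) (a : Particle N) (r : ℝ)
    (e : ℕ × Particle N → ℝ) (t : ℝ) : Option (State N) :=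
  if t < r then some z else (z.ring a).bind fun w => process lam w e (t - r)

theorem ringChain_consClock_of_none (z : State N) (ε : Particle N → ℝ) (e : ℕ × Particle N → ℝ)
    (h : z.ring (firstRing lam z ε) = none) (n : ℕ) :
    ringChain lam z (consClock ε e) (n + 1) =
      (clockTime lam z ε (firstRing lam z ε), none) := by
  induction n with
  | zero =>
    simp only [ringChain, consClock, zero_add]
    exact Prod.ext rfl h
  | succ n ih => rw [ringChain, ih]

theorem ringChain_consClock_of_some (z : State N) (ε : Particle N → ℝ) (e : ℕ × Particle N → ℝ)
    {w : State N} (h : z.ring (firstRing lam z ε) = some w) (n : ℕ) :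
    ringChain lam z (consClock ε e) (n + 1) =
      (clockTime lam z ε (firstRing lam z ε) + (ringChain lam w e n).1,
        (ringChain lam w e n).2) := by
  induction n with
  | zero =>
    simp only [ringChain, consClock, zero_add, add_zero]
    exact Prod.ext rfl h
  | succ n ih =>
    rw [ringChain, ih, ringChain]
    rcases ringChain lam w e n with ⟨s, _ | v⟩
    · rfl
    · simp only [consClock, add_assoc]

theorem ringChain_consClock_one_fst (z : State N) (ε : Particle N → ℝ)
    (e : ℕ × Particle N → ℝ) :
    (ringChain lam z (consClock ε e) 1).1 = clockTime lam z ε (firstRing lam z ε) := by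
  simp only [ringChain, consClock, zero_add]

/-- A pathwise identity: since no positivity of the clocks is assumed, the admissible index need not
be unique, and the minimal one is tracked through the shift by one ring. -/
theorem process_consClock (z : State N) (ε : Particle N → ℝ) (e : ℕ × Particle N → ℝ)
    {t : ℝ} (ht : 0 ≤ t) :
    process lam z (consClock ε e) t =
      stepProcess lam z (firstRing lam z ε) (clockTime lam z ε (firstRing lam z ε)) e t := by
  unfold stepProcess
  split_ifs with hlt
  · have h0 : (ringChain lam z (consClock ε e) 0).1 ≤ t ∧
        t < (ringChain lam z (consClock ε e) (0 + 1)).1 :=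
      ⟨ht, by rw [zero_add, ringChain_consClock_one_fst]; exact hlt⟩
    have h : ∃ n, (ringChain lam z (consClock ε e) n).1 ≤ t ∧
        t < (ringChain lam z (consClock ε e) (n + 1)).1 := ⟨0, h0⟩
    rw [process, dif_pos h, (Nat.find_eq_zero h).2 h0]
    rfl
  · have h0 : ¬((ringChain lam z (consClock ε e) 0).1 ≤ t ∧
        t < (ringChain lam z (consClock ε e) (0 + 1)).1) := fun h' => by
      rw [zero_add, ringChain_consClock_one_fst] at h'
      exact hlt h'.2
    rcases hring : z.ring (firstRing lam z ε) with _ | w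
    -- After killing the recorded time stays constant, so no index satisfies the strict inequality
    -- and the default value `none` is returned.
    · rw [process, dif_neg]
      · rfl
      · rintro ⟨_ | n, hn⟩
        · exact h0 hn
        · rw [ringChain_consClock_of_none z ε e hring,
            ringChain_consClock_of_none z ε e hring] at hn
          exact hlt hn.2
    · have hiff : ∀ n, ((ringChain lam z (consClock ε e) (n + 1)).1 ≤ t ∧
          t < (ringChain lam z (consClock ε e) (n + 1 + 1)).1) ↔
          ((ringChain lam w e n).1 ≤ t - clockTime lam z ε (firstRing lam z ε) ∧
          t - clockTime lam z ε (firstRing lam z ε) < (ringChain lam w e (n + 1)).1) := by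
        intro n
        rw [ringChain_consClock_of_some z ε e hring, ringChain_consClock_of_some z ε e hring,
          le_sub_iff_add_le', sub_lt_iff_lt_add']
      rw [Option.bind_some, process, process]
      by_cases h' : ∃ n, (ringChain lam w e n).1 ≤ t - clockTime lam z ε (firstRing lam z ε) ∧
          t - clockTime lam z ε (firstRing lam z ε) < (ringChain lam w e (n + 1)).1
      · have h : ∃ n, (ringChain lam z (consClock ε e) n).1 ≤ t ∧
            t < (ringChain lam z (consClock ε e) (n + 1)).1 :=
          h'.elim fun n hn => ⟨n + 1, (hiff n).2 hn⟩
        have hfind : Nat.find h = Nat.find h' + 1 := by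
          rw [Nat.find_eq_iff]
          refine ⟨(hiff _).2 (Nat.find_spec h'), ?_⟩
          rintro (_ | m) hm
          · exact h0
          · rw [hiff]
            exact Nat.find_min h' (by omega)
        rw [dif_pos h, dif_pos h', hfind, ringChain_consClock_of_some z ε e hring]
      · rw [dif_neg h', dif_neg]
        rintro ⟨_ | n, hn⟩
        · exact h0 hn
        · exact h' ⟨n, (hiff n).1 hn⟩

/-! ### Measurability -/

instance : DiscreteMeasurableSpace (Particle N) :=
  ⟨fun _ => measurableSet_sum_iff.2 ⟨.of_discrete, .of_discrete⟩⟩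

instance : Countable (State N) :=
  Function.Injective.countable (f := fun z : State N => (z.y, z.x)) fun _ _ h =>
    State.ext (congrArg Prod.fst h) (congrArg Prod.snd h)

instance : MeasurableSpace (Option (State N)) := ⊤

instance : DiscreteMeasurableSpace (Option (State N)) := ⟨fun _ => trivial⟩

theorem firstRing_spec (z : State N) (ε : Particle N → ℝ) (a : Particle N) :
    clockTime lam z ε (firstRing lam z ε) ≤ clockTime lam z ε a :=
  (Finite.exists_min (clockTime lam z ε)).choose_spec a

@[fun_prop]
theorem measurable_clockTime (z : State N) (a : Particle N) :
    Measurable fun ε => clockTime lam z ε a := by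
  unfold clockTime
  fun_prop

@[fun_prop]
theorem measurable_firstRing (z : State N) : Measurable (firstRing lam z) := by
  classical
  -- The choice depends on the clocks only through the set of minimising particles, and there are
  -- finitely many such sets.
  let H : (Particle N → Prop) → Particle N := fun p =>
    if h : ∃ a, p a then h.choose else Sum.inr 0
  have h : firstRing lam z =
      H ∘ fun ε a => ∀ b, clockTime lam z ε a ≤ clockTime lam z ε b := by
    funext ε
    exact (dif_pos (Finite.exists_min (clockTime lam z ε))).symm
  rw [h]
  refine (measurable_of_finite H).comp (measurable_pi_iff.2 fun a => ?_)
  refine measurableSet_setOfPred.1 ?_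
  rw [Set.ofPred_forall]
  exact MeasurableSet.iInter fun b => measurableSet_le (by fun_prop) (by fun_prop)

theorem measurable_clockTime_firstRing (z : State N) :
    Measurable fun ε => clockTime lam z ε (firstRing lam z ε) := by
  have h : Measurable fun p : (Particle N → ℝ) × Particle N => clockTime lam z p.1 p.2 :=
    measurable_from_prod_countable_left fun a => measurable_clockTime z a
  exact h.comp (measurable_id.prodMk (measurable_firstRing z))

@[fun_prop]
theorem measurable_ringChain (z : State N) (n : ℕ) :
    Measurable fun e => ringChain lam z e n := by
  induction n with
  | zero => exact measurable_const
  | succ n ih =>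
    let G : (ℝ × (Particle N → ℝ)) × Option (State N) → ℝ × Option (State N) := fun p =>
      match p with
      | ((s, _), none) => (s, none)
      | ((s, ε), some w) =>
        (s + clockTime lam w ε (firstRing lam w ε), w.ring (firstRing lam w ε))
    have hG : Measurable G := by
      refine measurable_from_prod_countable_left fun o => ?_
      rcases o with _ | w
      · exact measurable_fst.prodMk measurable_const
      · exact (measurable_fst.add ((measurable_clockTime_firstRing w).comp measurable_snd)).prodMk
          ((Measurable.of_discrete (f := w.ring)).comp
            ((measurable_firstRing w).comp measurable_snd))
    have h : (fun e => ringChain lam z e (n + 1)) = fun e =>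
        G (((ringChain lam z e n).1, fun a => e (n, a)), (ringChain lam z e n).2) := by
      funext e
      rw [ringChain]
      rcases ringChain lam z e n with ⟨s, _ | w⟩ <;> rfl
    rw [h]
    exact hG.comp ((ih.fst.prodMk (by fun_prop)).prodMk ih.snd)

theorem measurableSet_process_eq (z w : State N) :
    MeasurableSet {p : (ℕ × Particle N → ℝ) × ℝ | process lam z p.1 p.2 = some w} := by
  have h : {p : (ℕ × Particle N → ℝ) × ℝ | process lam z p.1 p.2 = some w} =
      ⋃ n, (({p | (ringChain lam z p.1 n).1 ≤ p.2} ∩ {p | p.2 < (ringChain lam z p.1 (n + 1)).1}) ∩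
        (⋂ m : Fin n, ({p | (ringChain lam z p.1 m).1 ≤ p.2} ∩
          {p | p.2 < (ringChain lam z p.1 (m + 1)).1})ᶜ)) ∩
        {p | (ringChain lam z p.1 n).2 = some w} := by
    ext p
    simp only [Set.mem_ofPred_eq, Set.mem_iUnion, Set.mem_inter_iff, Set.mem_iInter,
      Set.mem_compl_iff]
    rw [process]
    constructor
    · intro hp
      split_ifs at hp with h
      exact ⟨Nat.find h, ⟨Nat.find_spec h, fun m => Nat.find_min h m.2⟩, hp⟩
    · rintro ⟨n, ⟨hn, hm⟩, hw⟩
      have h : ∃ n, (ringChain lam z p.1 n).1 ≤ p.2 ∧ p.2 < (ringChain lam z p.1 (n + 1)).1 :=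
        ⟨n, hn⟩
      rw [dif_pos h, (Nat.find_eq_iff h).2 ⟨hn, fun m hmn => hm ⟨m, hmn⟩⟩, hw]
  rw [h]
  refine MeasurableSet.iUnion fun n => MeasurableSet.inter (MeasurableSet.inter ?_ ?_) ?_
  · exact (measurableSet_le (by fun_prop) (by fun_prop)).inter
      (measurableSet_lt (by fun_prop) (by fun_prop))
  · exact MeasurableSet.iInter fun m => ((measurableSet_le (by fun_prop) (by fun_prop)).inter
      (measurableSet_lt (by fun_prop) (by fun_prop))).compl
  · exact ((measurable_ringChain z n).comp measurable_fst).snd (measurableSet_singleton (some w))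

theorem measurableSet_stepProcess_eq (z : State N) (a : Particle N) (t : ℝ) (w : State N) :
    MeasurableSet {p : ℝ × (ℕ × Particle N → ℝ) | stepProcess lam z a p.1 p.2 t = some w} := by
  unfold stepProcess
  have h : {p : ℝ × (ℕ × Particle N → ℝ) | (if t < p.1 then some z else
      (z.ring a).bind fun w => process lam w p.2 (t - p.1)) = some w} =
      ({p | t < p.1} ∩ {p | some z = some w}) ∪
        ({p | t < p.1}ᶜ ∩ {p | ((z.ring a).bind fun w => process lam w p.2 (t - p.1)) = some w}) := by
    ext p
    simp only [Set.mem_ofPred_eq, Set.mem_union, Set.mem_inter_iff, Set.mem_compl_iff]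
    split_ifs with hp <;> simp [hp]
  have h1 : MeasurableSet {p : ℝ × (ℕ × Particle N → ℝ) | t < p.1} :=
    measurableSet_lt (by fun_prop) (by fun_prop)
  rw [h]
  refine (h1.inter (.const _)).union (h1.compl.inter ?_)
  rcases z.ring a with _ | v
  · simp
  · have : Measurable fun p : ℝ × (ℕ × Particle N → ℝ) => (p.2, t - p.1) := by fun_prop
    exact this (measurableSet_process_eq v w)

/-! ### The law of the clocks -/

/-- The law of a family of independent standard exponential clocks. -/
noncomputable def clockLaw (N : ℕ) : Measure (ℕ × Particle N → ℝ) :=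
  Measure.infinitePi fun _ => expMeasure 1

instance : IsProbabilityMeasure (clockLaw N) := by
  have := isProbabilityMeasure_expMeasure one_pos
  unfold clockLaw
  infer_instance

theorem measurable_consClock :
    Measurable fun q : (Particle N → ℝ) × (ℕ × Particle N → ℝ) => consClock q.1 q.2 := by
  refine measurable_pi_iff.2 ?_
  rintro ⟨_ | n, a⟩
  · exact (measurable_pi_apply a).comp measurable_fst
  · exact (measurable_pi_apply (n, a)).comp measurable_snd

/-- The preimage of a finite-dimensional box is the product of a box in the first round and a box in
the later rounds, so prepending a fresh round preserves the law. -/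
theorem map_consClock : ((Measure.pi fun _ : Particle N => expMeasure 1).prod (clockLaw N)).map
    (fun q => consClock q.1 q.2) = clockLaw N := by
  classical
  have := isProbabilityMeasure_expMeasure one_pos
  refine Measure.eq_infinitePi _ fun s t ht => ?_
  rw [Measure.map_apply measurable_consClock (MeasurableSet.pi s.countable_toSet fun i _ => ht i)]
  have hi0 : Function.Injective fun a : Particle N => ((0 : ℕ), a) := fun a b h => by
    simpa using h
  have hi1 : Function.Injective fun p : ℕ × Particle N => (p.1 + 1, p.2) := fun p q h => by
    simpa [Prod.ext_iff] using h
  have hset : (fun q : (Particle N → ℝ) × (ℕ × Particle N → ℝ) => consClock q.1 q.2) ⁻¹'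
      (Set.pi s t) =
      (Set.pi (s.preimage _ hi0.injOn : Finset (Particle N)) fun a => t (0, a)) ×ˢ
        (Set.pi (s.preimage _ hi1.injOn : Finset (ℕ × Particle N)) fun p => t (p.1 + 1, p.2)) := by
    ext q
    simp only [Set.mem_preimage, Set.mem_pi, Set.mem_prod, Finset.mem_coe, Finset.mem_preimage]
    constructor
    · intro h
      exact ⟨fun a ha => h (0, a) ha, fun p hp => h (p.1 + 1, p.2) hp⟩
    · rintro ⟨h0, h1⟩ ⟨_ | n, a⟩ ha
      · exact h0 a ha
      · exact h1 (n, a) ha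
  rw [hset, Measure.prod_prod, ← Measure.infinitePi_eq_pi, clockLaw,
    Measure.infinitePi_pi _ fun i _ => ht _, Measure.infinitePi_pi _ fun i _ => ht _,
    Finset.prod_preimage' _ _ hi0.injOn fun p => expMeasure 1 (t p),
    Finset.prod_preimage' _ _ hi1.injOn fun p => expMeasure 1 (t p),
    ← Finset.prod_filter_mul_prod_filter_not s (· ∈ Set.range fun a : Particle N => ((0 : ℕ), a))]
  congr 1
  refine Finset.prod_congr (Finset.filter_congr ?_) fun _ _ => rfl
  rintro ⟨_ | n, a⟩ _ <;> simp

theorem clockLaw_apply {E : Set (ℕ × Particle N → ℝ)} (hE : MeasurableSet E) :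
    clockLaw N E = ∫⁻ ε, clockLaw N {e | consClock ε e ∈ E}
      ∂Measure.pi (fun _ : Particle N => expMeasure 1) := by
  have := isProbabilityMeasure_expMeasure one_pos
  conv_lhs => rw [← map_consClock]
  rw [Measure.map_apply measurable_consClock hE, Measure.prod_apply (measurable_consClock hE)]
  rfl

/-! ### Path events and their decomposition at the first ring -/

/-- The clocks for which the process started from `z` is in state `w k` at time `s + d k`, for all
`k ≤ n`. -/
def pathEvent (lam : ℕ → ℝ) (n : ℕ) (d : ℕ → ℝ) (w : ℕ → State N) (z : State N) (s : ℝ) :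
    Set (ℕ × Particle N → ℝ) :=
  {e | ∀ k ≤ n, process lam z e (s + d k) = some (w k)}

/-- The later rounds of the clocks for which, if the first ring is that of the clock of `a` at time
`r`, the process started from `z` is in state `w k` at time `s + d k`, for all `k ≤ n`. -/
def stepEvent (lam : ℕ → ℝ) (n : ℕ) (d : ℕ → ℝ) (w : ℕ → State N) (z : State N) (s : ℝ)
    (a : Particle N) (r : ℝ) : Set (ℕ × Particle N → ℝ) :=
  {e | ∀ k ≤ n, stepProcess lam z a r e (s + d k) = some (w k)}

variable {n : ℕ} {d : ℕ → ℝ} {w : ℕ → State N}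

theorem measurableSet_pathEvent_prod (z : State N) (f : ℝ → ℝ) (hf : Measurable f) :
    MeasurableSet {p : ℝ × (ℕ × Particle N → ℝ) | p.2 ∈ pathEvent lam n d w z (f p.1)} := by
  simp only [pathEvent, Set.mem_ofPred_eq]
  simp only [Set.ofPred_forall]
  refine MeasurableSet.iInter fun k => MeasurableSet.iInter fun _ => ?_
  have : Measurable fun p : ℝ × (ℕ × Particle N → ℝ) => (p.2, f p.1 + d k) := by fun_prop
  exact this (measurableSet_process_eq z (w k))

theorem measurableSet_pathEvent (z : State N) (s : ℝ) :
    MeasurableSet (pathEvent lam n d w z s) :=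
  (measurable_const.prodMk measurable_id :
    Measurable fun e : ℕ × Particle N → ℝ => (s, e)) (measurableSet_pathEvent_prod z id measurable_id)

theorem measurable_clockLaw_pathEvent (z : State N) :
    Measurable fun s => clockLaw N (pathEvent lam n d w z s) :=
  measurable_measure_prodMk_left (measurableSet_pathEvent_prod z id measurable_id)

theorem measurable_clockLaw_stepEvent (z : State N) (s : ℝ) (a : Particle N) :
    Measurable fun r => clockLaw N (stepEvent lam n d w z s a r) := by
  have : MeasurableSet {p : ℝ × (ℕ × Particle N → ℝ) |
      p.2 ∈ stepEvent lam n d w z s a p.1} := by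
    simp only [stepEvent, Set.mem_ofPred_eq]
    simp only [Set.ofPred_forall]
    exact MeasurableSet.iInter fun k => MeasurableSet.iInter fun _ =>
      measurableSet_stepProcess_eq z a _ (w k)
  exact measurable_measure_prodMk_left this

/-- The total rate of the clocks in state `z`. -/
noncomputable def totalRate (lam : ℕ → ℝ) (z : State N) : ℝ := ∑ a, lam (z.pos a)

theorem clockLaw_pathEvent (hlam : UniformlyBounded lam) (hd : ∀ k, 0 ≤ d k) (z : State N) {s : ℝ}
    (hs : 0 ≤ s) :
    clockLaw N (pathEvent lam n d w z s) = ∑ a, ∫⁻ r in Set.Ioi 0,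
      ENNReal.ofReal (lam (z.pos a) * Real.exp (-(totalRate lam z * r))) *
        clockLaw N (stepEvent lam n d w z s a r) := by
  rw [clockLaw_apply (measurableSet_pathEvent z s), totalRate,
    ← lintegral_firstRing (fun a => hlam.pos (z.pos a)) (b := firstRing lam z)
      (fun ε a => firstRing_spec z ε a) (measurable_clockLaw_stepEvent z s)]
  refine lintegral_congr fun ε => ?_
  congr 1
  ext e
  refine forall_congr' fun k => forall_congr' fun _ => ?_
  rw [process_consClock z ε e (add_nonneg hs (hd k))]
  rfl

/-- Only almost sure: a nonpositive first clock value is a null event, but it would spoil the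
identity. -/
theorem ae_process_zero (hlam : UniformlyBounded lam) (z : State N) :
    ∀ᵐ e ∂clockLaw N, process lam z e 0 = some z := by
  have := isProbabilityMeasure_expMeasure one_pos
  have h := clockLaw_pathEvent (n := 0) (d := fun _ => 0) (w := fun _ => z) hlam (fun _ => le_rfl)
    z le_rfl
  have h' : ∀ a, ∀ r ∈ Set.Ioi (0 : ℝ), clockLaw N
      (stepEvent lam 0 (fun _ => 0) (fun _ => z) z 0 a r) = 1 := by
    intro a r hr
    rw [← measure_univ (μ := clockLaw N)]
    congr 1
    ext e
    simp only [stepEvent, stepProcess, add_zero, Set.mem_ofPred_eq, Set.mem_univ, iff_true]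
    intro _ _
    exact if_pos hr
  have h1 := lintegral_firstRing (fun a => hlam.pos (z.pos a)) (b := firstRing lam z)
      (fun ε a => firstRing_spec z ε a) (F := fun _ _ => 1) (fun _ => measurable_const)
  rw [lintegral_one, measure_univ] at h1
  have h2 : clockLaw N (pathEvent lam 0 (fun _ => 0) (fun _ => z) z 0) = 1 := by
    rw [h, h1]
    refine Finset.sum_congr rfl fun a _ => setLIntegral_congr_fun measurableSet_Ioi fun r hr => ?_
    rw [h' a r hr, totalRate]
  filter_upwards [(mem_ae_iff_prob_eq_one (measurableSet_pathEvent z 0)).2 h2] with e he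
  simpa using he 0 le_rfl

/-! ### The renewal equation -/

/-- The integrand of the renewal equation. -/
noncomputable def renewalIntegrand (lam : ℕ → ℝ) (V : State N → ℝ → ℝ) (z : State N) (s r : ℝ) :
    ℝ :=
  Real.exp (-(totalRate lam z * r)) *
    ∑ a, lam (z.pos a) * (z.ring a).elim 0 fun w => V w (s - r)

/-- The renewal equation at the first ring, for a function `V` of the initial state and of the
time. -/
def IsRenewal (lam : ℕ → ℝ) (V : State N → ℝ → ℝ) : Prop :=
  ∀ z s, 0 ≤ s → IntervalIntegrable (renewalIntegrand lam V z s) volume 0 s ∧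
    V z s = Real.exp (-(totalRate lam z * s)) * V z 0 +
      ∫ r in (0 : ℝ)..s, renewalIntegrand lam V z s r

theorem totalRate_pos (hlam : UniformlyBounded lam) (z : State N) : 0 < totalRate lam z :=
  Finset.sum_pos (fun a _ => hlam.pos (z.pos a)) Finset.univ_nonempty

theorem integral_mul_exp_neg_mul (c s : ℝ) :
    ∫ r in (0 : ℝ)..s, c * Real.exp (-(c * r)) = 1 - Real.exp (-(c * s)) := by
  have h : ∀ r ∈ Set.uIcc 0 s, HasDerivAt (fun r => -Real.exp (-(c * r)))
      (c * Real.exp (-(c * r))) r := fun r _ => hasDerivAt_neg_exp_mul_exp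
  rw [intervalIntegral.integral_eq_sub_of_hasDerivAt h
    (Continuous.intervalIntegrable (by fun_prop) _ _)]
  simp
  ring

/-- One application of the renewal equation contracts the difference of two solutions. -/
theorem IsRenewal.abs_sub_le (hlam : UniformlyBounded lam) {V W : State N → ℝ → ℝ}
    (hV : IsRenewal lam V) (hW : IsRenewal lam W) (h0 : ∀ z, V z 0 = W z 0) {C T K : ℝ}
    (hC : ∀ z : State N, totalRate lam z ≤ C) (hK0 : 0 ≤ K)
    (hK : ∀ z s, 0 ≤ s → s ≤ T → |V z s - W z s| ≤ K) (z : State N) {s : ℝ} (hs : 0 ≤ s)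
    (hsT : s ≤ T) : |V z s - W z s| ≤ (1 - Real.exp (-(C * T))) * K := by
  have hL := (totalRate_pos hlam z).le
  obtain ⟨hVi, hVe⟩ := hV z s hs
  obtain ⟨hWi, hWe⟩ := hW z s hs
  have hsub : V z s - W z s = ∫ r in (0 : ℝ)..s,
      (renewalIntegrand lam V z s r - renewalIntegrand lam W z s r) := by
    rw [intervalIntegral.integral_sub hVi hWi, hVe, hWe, h0 z]
    ring
  have hbound : ∀ r ∈ Set.Ioc 0 s, ‖renewalIntegrand lam V z s r - renewalIntegrand lam W z s r‖ ≤
      totalRate lam z * Real.exp (-(totalRate lam z * r)) * K := by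
    intro r hr
    rw [renewalIntegrand, renewalIntegrand, ← mul_sub, ← Finset.sum_sub_distrib, Real.norm_eq_abs,
      abs_mul, abs_of_pos (Real.exp_pos _),
      show totalRate lam z * Real.exp (-(totalRate lam z * r)) * K =
        Real.exp (-(totalRate lam z * r)) * (totalRate lam z * K) by ring]
    refine mul_le_mul_of_nonneg_left ?_ (Real.exp_pos _).le
    rw [totalRate, Finset.sum_mul]
    refine (Finset.abs_sum_le_sum_abs _ _).trans (Finset.sum_le_sum fun a _ => ?_)
    rw [← mul_sub, abs_mul, abs_of_pos (hlam.pos _)]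
    refine mul_le_mul_of_nonneg_left ?_ (hlam.pos _).le
    rcases z.ring a with _ | w
    · simpa using hK0
    · exact hK w (s - r) (by linarith [hr.2]) (by linarith [hr.1])
  rw [hsub, ← Real.norm_eq_abs]
  refine (intervalIntegral.norm_integral_le_of_norm_le hs
    (Filter.Eventually.of_forall hbound)
    (Continuous.intervalIntegrable (by fun_prop) _ _)).trans ?_
  -- The factor is the probability that some clock rings before time `s`, bounded uniformly in the
  -- state by means of `C` and `T`.
  rw [intervalIntegral.integral_mul_const, integral_mul_exp_neg_mul]
  have h1 := hC z
  have h2 := hL.trans h1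
  gcongr

/-- Iterating the contraction on `[0, s]` bounds the difference by `c ^ m * K` with `c < 1`
independent of the state. -/
theorem IsRenewal.unique (hlam : UniformlyBounded lam) {V W : State N → ℝ → ℝ}
    (hV : IsRenewal lam V) (hW : IsRenewal lam W) (h0 : ∀ z, V z 0 = W z 0)
    (hb : ∀ T, ∃ K, 0 ≤ K ∧ ∀ z s, 0 ≤ s → s ≤ T → |V z s - W z s| ≤ K) (z : State N) {s : ℝ}
    (hs : 0 ≤ s) : V z s = W z s := by
  obtain ⟨M, hM0, hM⟩ := hlam.exists_le
  set C : ℝ := ∑ _a : Particle N, M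
  have hC : ∀ z : State N, totalRate lam z ≤ C := fun z => Finset.sum_le_sum fun a _ => hM _
  have hC0 : 0 ≤ C := Finset.sum_nonneg fun _ _ => hM0.le
  set c := 1 - Real.exp (-(C * s))
  have hc0 : 0 ≤ c := by
    have : Real.exp (-(C * s)) ≤ 1 := Real.exp_le_one_iff.2 (by simpa using mul_nonneg hC0 hs)
    simp only [c]
    linarith
  have hc1 : c < 1 := by
    have := Real.exp_pos (-(C * s))
    simp only [c]
    linarith
  obtain ⟨K, hK0, hK⟩ := hb s
  have key : ∀ m : ℕ, ∀ z r, 0 ≤ r → r ≤ s → |V z r - W z r| ≤ c ^ m * K := by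
    intro m
    induction m with
    | zero => simpa using hK
    | succ m ih =>
      intro z r hr hrs
      rw [pow_succ', mul_assoc]
      exact hV.abs_sub_le hlam hW h0 hC (by positivity) ih z hr hrs
  have hlim : Filter.Tendsto (fun m : ℕ => c ^ m * K) Filter.atTop (nhds 0) := by
    simpa using (tendsto_pow_atTop_nhds_zero_of_lt_one hc0 hc1).mul_const K
  have := ge_of_tendsto' hlim fun m => key m z s hs le_rfl
  exact sub_eq_zero.1 (abs_nonpos_iff.1 this)

/-- The kernel solves the renewal equation. -/
theorem isRenewal_kernelU (hlam : UniformlyBounded lam) (z' : State N) (c : ℝ) :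
    IsRenewal lam fun z s => kernelU lam s z z' * c := by
  intro z s _
  have hcont : ∀ w : State N, Continuous fun r => kernelU lam r w z' := fun w =>
    continuous_iff_continuousAt.2 fun t => (hasDerivAt_kernelU hlam t w z').continuousAt
  have hI : Continuous (renewalIntegrand lam (fun z s => kernelU lam s z z' * c) z s) := by
    unfold renewalIntegrand
    refine Continuous.mul (by fun_prop) (continuous_finsetSum _ fun a _ => ?_)
    refine Continuous.mul continuous_const ?_
    rcases z.ring a with _ | w
    · exact continuous_const
    · exact ((hcont w).comp (continuous_const.sub continuous_id)).mul continuous_const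
  refine ⟨hI.intervalIntegrable _ _, ?_⟩
  -- Duhamel's formula: in the derivative of `-exp(-Λ r) U_{s-r}`, with `Λ` the total rate, the
  -- diagonal part of the generator cancels against the derivative of the exponential.
  have hderiv : ∀ r ∈ Set.uIcc 0 s, HasDerivAt
      (fun r => -(Real.exp (-(totalRate lam z * r)) * (kernelU lam (s - r) z z' * c)))
      (renewalIntegrand lam (fun z s => kernelU lam s z z' * c) z s r) r := by
    intro r _
    have h1 : HasDerivAt (fun r => Real.exp (-(totalRate lam z * r)))
        (-(totalRate lam z * Real.exp (-(totalRate lam z * r)))) r := by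
      simpa using (hasDerivAt_neg_exp_mul_exp (r := totalRate lam z) (x := r)).fun_neg
    have h2 := HasDerivAt.comp_const_sub s r (hasDerivAt_kernelU hlam (s - r) z z')
    refine (h1.mul (h2.mul_const c)).neg.congr_deriv ?_
    have h3 : generator lam (fun w => kernelU lam (s - r) w z') z =
        (∑ a, lam (z.pos a) * (z.ring a).elim 0 fun w => kernelU lam (s - r) w z') -
          totalRate lam z * kernelU lam (s - r) z z' := by
      rw [generator, totalRate, Finset.sum_mul, ← Finset.sum_sub_distrib]
      exact Finset.sum_congr rfl fun a _ => mul_sub _ _ _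
    have h4 : (∑ a, lam (z.pos a) * (z.ring a).elim 0 fun w => kernelU lam (s - r) w z' * c) =
        (∑ a, lam (z.pos a) * (z.ring a).elim 0 fun w => kernelU lam (s - r) w z') * c := by
      rw [Finset.sum_mul]
      refine Finset.sum_congr rfl fun a _ => ?_
      rcases z.ring a with _ | w
      · simp
      · simp only [Option.elim_some]
        ring
    rw [renewalIntegrand, h4, h3]
    ring
  rw [intervalIntegral.integral_eq_sub_of_hasDerivAt hderiv (hI.intervalIntegrable _ _)]
  simp

theorem stepEvent_of_le (z : State N) {s r : ℝ} (hd : ∀ k, 0 ≤ d k) (hr : r ≤ s) (a : Particle N) :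
    stepEvent lam n d w z s a r =
      (z.ring a).elim ∅ fun v => pathEvent lam n d w v (s - r) := by
  have h : ∀ k, ¬ s + d k < r := fun k => by linarith [hd k]
  ext e
  simp only [stepEvent, stepProcess, if_neg (h _), Set.mem_ofPred_eq]
  rcases z.ring a with _ | v
  · simp only [Option.bind_none, Option.elim_none, Set.mem_empty_iff_false, iff_false]
    intro hk
    simpa using hk 0 (Nat.zero_le _)
  · simp only [Option.bind_some, Option.elim_some, pathEvent, Set.mem_ofPred_eq, add_sub_right_comm]

theorem stepEvent_add (z : State N) (s r : ℝ) (a : Particle N) :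
    stepEvent lam n d w z s a (s + r) = stepEvent lam n d w z 0 a r := by
  ext e
  simp only [stepEvent, stepProcess, Set.mem_ofPred_eq, add_lt_add_iff_left, add_sub_add_left_eq_sub,
    zero_add]

theorem lintegral_Ioi_eq_lintegral_Ioi_zero_add (s : ℝ) (f : ℝ → ENNReal) :
    ∫⁻ r in Set.Ioi s, f r = ∫⁻ r in Set.Ioi 0, f (s + r) := by
  have h := (measurePreserving_add_left (volume : Measure ℝ) s).setLIntegral_comp_preimage_emb
    (measurableEmbedding_addLeft s) f (Set.Ioi s)
  rw [← h]
  congr 2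
  ext r
  simp

/-! ### Path probabilities and the Markov property -/

/-- The probability that the process started from `z` is in state `w k` at time `s + d k`, for all
`k ≤ n`. -/
noncomputable def pathProb (lam : ℕ → ℝ) (n : ℕ) (d : ℕ → ℝ) (w : ℕ → State N) (z : State N)
    (s : ℝ) : ℝ :=
  (clockLaw N).real (pathEvent lam n d w z s)

theorem measurable_pathProb (z : State N) : Measurable (pathProb lam n d w z) :=
  (measurable_clockLaw_pathEvent z).ennreal_toReal

theorem pathProb_nonneg (z : State N) (s : ℝ) : 0 ≤ pathProb lam n d w z s := measureReal_nonneg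

theorem pathProb_le_one (z : State N) (s : ℝ) : pathProb lam n d w z s ≤ 1 := measureReal_le_one

/-- The finite-dimensional distributions of the dynamics solve the renewal equation. -/
theorem isRenewal_pathProb (hlam : UniformlyBounded lam) (hd : ∀ k, 0 ≤ d k) :
    IsRenewal lam (pathProb lam n d w) := by
  intro z s hs
  set g : Particle N → ℝ → ℝ := fun a r =>
    lam (z.pos a) * Real.exp (-(totalRate lam z * r)) *
      (z.ring a).elim 0 fun v => pathProb lam n d w v (s - r) with hg
  have hL := (totalRate_pos hlam z).le
  have helim0 : ∀ a r, 0 ≤ (z.ring a).elim 0 fun v => pathProb lam n d w v (s - r) := by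
    intro a r
    rcases z.ring a with _ | v
    · exact le_rfl
    · exact pathProb_nonneg _ _
  have helim1 : ∀ a r, ((z.ring a).elim 0 fun v => pathProb lam n d w v (s - r)) ≤ 1 := by
    intro a r
    rcases z.ring a with _ | v
    · exact zero_le_one
    · exact pathProb_le_one _ _
  have hg0 : ∀ a r, 0 ≤ g a r := fun a r =>
    mul_nonneg (mul_nonneg (hlam.pos _).le (Real.exp_pos _).le) (helim0 a r)
  have hgm : ∀ a, Measurable (g a) := by
    intro a
    refine Measurable.mul (by fun_prop) ?_
    rcases z.ring a with _ | v
    · exact measurable_const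
    · exact (measurable_pathProb v).comp (by fun_prop)
  have hgi : ∀ a, IntegrableOn (g a) (Set.Ioc 0 s) := by
    intro a
    refine Measure.integrableOn_of_bounded (M := lam (z.pos a)) (by simp)
      (hgm a).aestronglyMeasurable ?_
    refine (ae_restrict_iff' measurableSet_Ioc).2 (Filter.Eventually.of_forall fun r hr => ?_)
    rw [Real.norm_eq_abs, abs_of_nonneg (hg0 a r)]
    have hexp : Real.exp (-(totalRate lam z * r)) ≤ 1 :=
      Real.exp_le_one_iff.2 (by simpa using mul_nonneg hL hr.1.le)
    calc g a r ≤ lam (z.pos a) * 1 * 1 := by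
          refine mul_le_mul (mul_le_mul_of_nonneg_left hexp (hlam.pos _).le) (helim1 a r)
            (helim0 a r) (by simpa using (hlam.pos _).le)
      _ = lam (z.pos a) := by ring
  have hsum : renewalIntegrand lam (pathProb lam n d w) z s = fun r => ∑ a, g a r := by
    funext r
    rw [renewalIntegrand, Finset.mul_sum]
    refine Finset.sum_congr rfl fun a _ => ?_
    simp only [hg]
    ring
  have hII : ∀ a ∈ Finset.univ, IntervalIntegrable (g a) volume 0 s := fun a _ =>
    (intervalIntegrable_iff_integrableOn_Ioc_of_le hs).2 (hgi a)
  rw [hsum]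
  refine ⟨by rw [← Finset.sum_fn]; exact IntervalIntegrable.sum Finset.univ hII, ?_⟩
  rw [intervalIntegral.integral_finsetSum hII]
  set c : Particle N → ℝ → ENNReal := fun a r =>
    ENNReal.ofReal (lam (z.pos a) * Real.exp (-(totalRate lam z * r))) with hc
  have hcm : ∀ a, Measurable (c a) := fun a => by fun_prop
  have hcs : ∀ a, Measurable fun r => c a r * clockLaw N (stepEvent lam n d w z 0 a r) :=
    fun a => (hcm a).mul (measurable_clockLaw_stepEvent z 0 a)
  -- A first ring at `r ≤ s` restarts the process from the new state with time `s - r` left. For a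
  -- ring after `s`, the shift `r ↦ s + r` extracts `exp(-Λ s)`, by lack of memory, and leaves the
  -- same decomposition at `s = 0`.
  have hsplit : ∀ a, ∫⁻ r in Set.Ioi 0, c a r * clockLaw N (stepEvent lam n d w z s a r) =
      ENNReal.ofReal (∫ r in (0 : ℝ)..s, g a r) +
        ENNReal.ofReal (Real.exp (-(totalRate lam z * s))) *
          ∫⁻ r in Set.Ioi 0, c a r * clockLaw N (stepEvent lam n d w z 0 a r) := by
    intro a
    rw [← Set.Ioc_union_Ioi_eq_Ioi hs, lintegral_union measurableSet_Ioi
      (Set.disjoint_left.2 fun r h1 h2 => (Set.mem_Ioi.1 h2).not_ge h1.2)]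
    congr 1
    · rw [intervalIntegral.integral_of_le hs,
        ofReal_integral_eq_lintegral_ofReal (hgi a) (Filter.Eventually.of_forall (hg0 a))]
      refine setLIntegral_congr_fun measurableSet_Ioc fun r hr => ?_
      simp only [hc, hg]
      rw [stepEvent_of_le z hd hr.2,
        ENNReal.ofReal_mul (mul_nonneg (hlam.pos _).le (Real.exp_pos _).le)]
      congr 1
      rcases z.ring a with _ | v
      · simp
      · exact (ofReal_measureReal).symm
    · rw [Set.Ioc_union_Ioi_eq_Ioi hs, lintegral_Ioi_eq_lintegral_Ioi_zero_add,
        ← lintegral_const_mul _ (hcs a)]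
      refine lintegral_congr fun r => ?_
      simp only [hc]
      rw [stepEvent_add, ← mul_assoc, ← ENNReal.ofReal_mul (Real.exp_pos _).le]
      congr 2
      rw [mul_add, neg_add, Real.exp_add]
      ring
  have h0 : ∀ a, 0 ≤ ∫ r in (0 : ℝ)..s, g a r := fun a =>
    intervalIntegral.integral_nonneg hs fun r _ => hg0 a r
  have key : clockLaw N (pathEvent lam n d w z s) =
      ∑ a, ∫⁻ r in Set.Ioi 0, c a r * clockLaw N (stepEvent lam n d w z s a r) :=
    clockLaw_pathEvent hlam hd z hs
  have key0 : clockLaw N (pathEvent lam n d w z 0) =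
      ∑ a, ∫⁻ r in Set.Ioi 0, c a r * clockLaw N (stepEvent lam n d w z 0 a r) :=
    clockLaw_pathEvent hlam hd z le_rfl
  rw [Finset.sum_congr rfl fun a _ => hsplit a, Finset.sum_add_distrib, ← Finset.mul_sum, ← key0,
    ← ENNReal.ofReal_sum_of_nonneg fun a _ => h0 a,
    ← ofReal_measureReal (s := pathEvent lam n d w z 0), ← ENNReal.ofReal_mul (Real.exp_pos _).le,
    ← ENNReal.ofReal_add (Finset.sum_nonneg fun a _ => h0 a)
      (mul_nonneg (Real.exp_pos _).le measureReal_nonneg)] at key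
  rw [pathProb, measureReal_def, key, ENNReal.toReal_ofReal (add_nonneg
    (Finset.sum_nonneg fun a _ => h0 a) (mul_nonneg (Real.exp_pos _).le measureReal_nonneg)),
    add_comm]
  rfl

/-- The Markov property at the first of the prescribed times. -/
theorem pathProb_eq_kernelU_mul (hlam : UniformlyBounded lam) (hd : ∀ k, 0 ≤ d k) (hd0 : d 0 = 0)
    (z : State N) {s : ℝ} (hs : 0 ≤ s) :
    pathProb lam n d w z s = kernelU lam s z (w 0) * pathProb lam n d w (w 0) 0 := by
  -- Both sides solve the renewal equation, the second factor on the right being constant. At `s =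
  -- 0` both vanish unless `z = w 0`, because `d 0 = 0` forces the path to start at `w 0`.
  refine IsRenewal.unique hlam (isRenewal_pathProb hlam hd)
    (isRenewal_kernelU hlam (w 0) (pathProb lam n d w (w 0) 0)) (fun z => ?_) (fun T => ?_) z hs
  · by_cases hz : z = w 0
    · rw [hz, kernelU_zero_self hlam, one_mul]
    · rw [kernelU_zero_of_ne hlam hz, zero_mul, pathProb, measureReal_eq_zero_iff]
      refine measure_mono_null (fun e he => ?_) (ae_iff.1 (ae_process_zero hlam z))
      intro hp
      have h := he 0 (Nat.zero_le _)
      rw [hd0, add_zero, hp] at h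
      exact hz (Option.some_injective _ h)
  · obtain ⟨K, hK0, hK⟩ := exists_abs_kernelU_le (N := N) hlam T
    refine ⟨1 + K, by positivity, fun z s hs hsT => (abs_sub _ _).trans (add_le_add ?_ ?_)⟩
    · rw [abs_of_nonneg (pathProb_nonneg _ _)]
      exact pathProb_le_one _ _
    · rw [abs_mul, abs_of_nonneg (pathProb_nonneg _ _)]
      exact (mul_le_of_le_one_right (abs_nonneg _) (pathProb_le_one _ _)).trans
        (hK s hs hsT z (w 0))

/-! ### Transition probabilities and finite-dimensional distributions -/

theorem clockLaw_process_eq (hlam : UniformlyBounded lam) (z z' : State N) {t : ℝ} (ht : 0 ≤ t) :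
    (clockLaw N).real {e | process lam z e t = some z'} = kernelU lam t z z' := by
  have h := pathProb_eq_kernelU_mul (n := 0) (d := fun _ => 0) (w := fun _ => z') hlam
    (fun _ => le_rfl) rfl z ht
  have h1 : pathProb lam 0 (fun _ => 0) (fun _ => z') z' 0 = 1 := by
    have h2 : pathEvent lam 0 (fun _ => 0) (fun _ => z') z' 0 =ᵐ[clockLaw N] Set.univ := by
      filter_upwards [ae_process_zero hlam z'] with e he
      refine eq_true ?_
      intro k _
      rw [add_zero]
      exact he
    rw [pathProb, measureReal_congr h2, probReal_univ]
  rw [h1, mul_one] at h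
  rw [← h, pathProb, pathEvent]
  congr 1
  ext e
  simp

theorem kernelU_nonneg (hlam : UniformlyBounded lam) {t : ℝ} (ht : 0 ≤ t) (z z' : State N) :
    0 ≤ kernelU lam t z z' :=
  clockLaw_process_eq hlam z z' ht ▸ measureReal_nonneg

theorem measurableSet_process_eq_fixed (z z' : State N) (t : ℝ) :
    MeasurableSet {e | process lam z e t = some z'} :=
  (measurable_id.prodMk measurable_const :
    Measurable fun e : ℕ × Particle N → ℝ => (e, t)) (measurableSet_process_eq z z')

theorem sum_kernelU_le_one (hlam : UniformlyBounded lam) {t : ℝ} (ht : 0 ≤ t) (z : State N)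
    (S : Finset (State N)) : ∑ z' ∈ S, kernelU lam t z z' ≤ 1 := by
  simp only [← clockLaw_process_eq hlam z _ ht]
  rw [← measureReal_biUnion_finset]
  · exact measureReal_le_one
  · intro u _ v _ huv
    refine Set.disjoint_left.2 fun e hu hv => huv ?_
    exact Option.some_injective _ (Eq.trans (Eq.symm hu) hv)
  · exact fun z' _ => measurableSet_process_eq_fixed z z' t

/-- The finite-dimensional distributions of the dynamics. -/
theorem clockLaw_process_path (hlam : UniformlyBounded lam) (n : ℕ) (t : ℕ → ℝ)
    (w : ℕ → State N) (ht0 : t 0 = 0) (ht : Monotone t) :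
    (clockLaw N).real {e | ∀ k ≤ n, process lam (w 0) e (t k) = some (w k)} =
      ∏ k ∈ Finset.range n, kernelU lam (t (k + 1) - t k) (w k) (w (k + 1)) := by
  induction n generalizing t w with
  | zero =>
    rw [Finset.prod_range_zero, ← probReal_univ (μ := clockLaw N)]
    refine measureReal_congr ?_
    filter_upwards [ae_process_zero hlam (w 0)] with e he
    refine eq_true ?_
    intro k hk
    rw [Nat.le_zero.1 hk, ht0]
    exact he
  | succ n ih =>
    -- The condition at time `0` holds almost surely and is dropped; the remaining times are
    -- measured from `t 1`, where the Markov property is applied.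
    have h1 : {e | ∀ k ≤ n + 1, process lam (w 0) e (t k) = some (w k)} =ᵐ[clockLaw N]
        pathEvent lam n (fun k => t (k + 1) - t 1) (fun k => w (k + 1)) (w 0) (t 1) := by
      filter_upwards [ae_process_zero hlam (w 0)] with e he
      refine propext ⟨fun h k hk => ?_, fun h k hk => ?_⟩
      · rw [add_sub_cancel]
        exact h (k + 1) (by omega)
      · rcases k with _ | k
        · rw [ht0]
          exact he
        · have := h k (by omega)
          rwa [add_sub_cancel] at this
    have h2 := pathProb_eq_kernelU_mul (n := n) (d := fun k => t (k + 1) - t 1)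
      (w := fun k => w (k + 1)) hlam (fun k => sub_nonneg.2 (ht (by omega))) (sub_self _) (w 0)
      (s := t 1) (ht0 ▸ ht (Nat.zero_le 1))
    have h3 := ih (fun k => t (k + 1) - t 1) (fun k => w (k + 1)) (sub_self _)
      (fun i j hij => sub_le_sub_right (ht (by omega)) _)
    rw [measureReal_congr h1, Finset.prod_range_succ']
    refine h2.trans ?_
    rw [mul_comm, zero_add, ht0, sub_zero]
    congr 1
    rw [pathProb, pathEvent]
    simp only [zero_add, sub_sub_sub_cancel_right] at h3 ⊢
    exact h3

/-- Transfers results on the canonical space of clocks to any probability space carrying independent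
standard exponential variables. -/
theorem map_eq_clockLaw {Ω : Type*} [MeasurableSpace Ω] {P : Measure Ω} [IsProbabilityMeasure P]
    {e : ℕ × Particle N → Ω → ℝ} (hm : ∀ p, Measurable (e p))
    (hlaw : ∀ p, P.map (e p) = expMeasure 1) (hind : iIndepFun e P) :
    P.map (fun ω p => e p ω) = clockLaw N := by
  rw [(iIndepFun_iff_map_fun_eq_infinitePi_map hm).1 hind]
  simp only [hlaw]
  rfl

end TwoLevel

open MeasureTheory ProbabilityTheory TwoLevel in
theorem mainTheorem4 (N : ℕ) (lam : ℕ → ℝ) (hlam : UniformlyBounded lam) :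
    -- nonnegative and substochastic
    (∀ t : ℝ, 0 ≤ t → ∀ z z' : State N, 0 ≤ kernelU lam t z z') ∧
    (∀ t : ℝ, 0 ≤ t → ∀ z : State N,
      Summable (fun z' : State N => kernelU lam t z z') ∧
        ∑' z' : State N, kernelU lam t z z' ≤ 1) ∧
    -- the initial condition and the Kolmogorov backward equation
    (∀ z z' : State N, (z = z' → kernelU lam 0 z z' = 1) ∧ (z ≠ z' → kernelU lam 0 z z' = 0)) ∧
    (∀ t : ℝ, 0 ≤ t → ∀ z z' : State N,
      HasDerivWithinAt (fun r => kernelU lam r z z')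
        (generator lam (fun w => kernelU lam t w z') z) (Set.Ici 0) t) ∧
    -- the finite-dimensional distributions of the dynamics have the transition density `kernelU`
    (∀ (Ω : Type*) [MeasurableSpace Ω] (P : Measure Ω) [IsProbabilityMeasure P]
      (e : ℕ × Particle N → Ω → ℝ),
      (∀ p, Measurable (e p)) → (∀ p, P.map (e p) = expMeasure 1) → iIndepFun e P →
      ∀ (n : ℕ) (t : ℕ → ℝ) (w : ℕ → State N), t 0 = 0 → Monotone t →
        P.real {ω | ∀ k ≤ n, process lam (w 0) (fun p => e p ω) (t k) = some (w k)} =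
          ∏ k ∈ Finset.range n, kernelU lam (t (k + 1) - t k) (w k) (w (k + 1))) := by
  refine ⟨fun t ht z z' => kernelU_nonneg hlam ht z z', fun t ht z => ?_, fun z z' => ?_,
    fun t _ z z' => (hasDerivAt_kernelU hlam t z z').hasDerivWithinAt, ?_⟩
  · have hsum := summable_of_sum_le (fun z' => kernelU_nonneg hlam ht z z')
      (sum_kernelU_le_one hlam ht z)
    exact ⟨hsum, hsum.tsum_le_of_sum_le (sum_kernelU_le_one hlam ht z)⟩
  · exact ⟨fun h => h ▸ kernelU_zero_self hlam z, kernelU_zero_of_ne hlam⟩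
  · intro Ω _ P _ e hm hlaw hind n t w ht0 ht
    rw [← clockLaw_process_path hlam n t w ht0 ht, ← map_eq_clockLaw hm hlaw hind,
      map_measureReal_apply (measurable_pi_iff.2 hm)]
    · rfl
    · simp only [Set.ofPred_forall]
      exact MeasurableSet.iInter fun k => MeasurableSet.iInter fun _ =>
        measurableSet_process_eq_fixed _ _ _
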